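/- Let $(X,d)$ be a proper complete geodesic space, $\Omega\subset X$ a bounded open set, $f\in C(\Omega)$ with $f>0$ in $\Omega$, and $u\in C(\Omega)$. Consider the eikonal equation $|\nabla u|=f$ in $\Omega$. Then the following are equivalent: (a) $u$ is a local c-solution; (b) $u$ is an s-solution; (c) $u$ is a Monge solution. Every c-solution satisfies (a), hence also (b) and (c). If any of (a)–(c) holds, then $u$ is locally Lipschitz in $\Omega$ and $|\nabla u|(x)=|\nabla^-u|(x)=f(x)$ for all $x\in\Omega$. **Definitions.** *Slopes.* $|\nabla u|(x)=\limsup_{y\to x}\frac{|u(y)-u(x)|}{d(x,y)}$ and $|\nabla^\pm u|(x)=\limsup_{y\to x}\frac{[u(y)-u(x)]_\pm}{d(x,y)}$, where $[a]_\pm=\max\{\pm a,0\}$ (limits over $y\ne x$; the value is $0$ at an isolated point). Put $|\nabla\psi|^*(x)=\limsup_{y\to x}|\nabla\psi|(y)$, with $y=x$ allowed. *Curves.* $\mathcal A_x$ is the set of $1$-Lipschitz curves $\xi:\mathbb R\to X$ with $\xi(0)=x$. For an open set $O$, $T^+_O[\xi]=\inf\{t\ge 0:\xi(t)\notin O\}$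 and $T^-_O[\xi]=\sup\{t\le 0:\xi(t)\notin O\}$ (with $\inf\emptyset=+\infty$, $\sup\emptyset=-\infty$). For $x\in O$ and $\varepsilon>0$, a pair $(\xi,w)$ is called $\varepsilon$-good for $(x,O)$ if $\xi\in\mathcal A_x$, $w$ is a real-valued lower semicontinuous function on the interval $I=(T^-_O[\xi],T^+_O[\xi])$, $w(0)=u(x)$, $w\ge u\circ\xi-\varepsilon$ on $I$, and $|\phi'(t_0)|\ge f(\xi(t_0))-\varepsilon$ whenever $\phi\in C^1(\mathbb R)$ and $w-\phi$ has a local minimum at $t_0\in I$. *Curve-based solutions.* An upper semicontinuous $u$ is a c-subsolution if for all $x\in\Omega$ and all $\xi\in\mathcal A_x$ with $\xi(\mathbb R)\subset\Omega$ one has $|\phi'(0)|\le f(x)$ whenever $\phi\in C^1(\mathbb R)$ and $u\circ\xi-\phi$ has a local maximum at $0$. A lower semicontinuous $u$ is a c-supersolution if for all $\varepsilon>0$ and $x\in\Omega$ there is an $\varepsilon$-good pair $(\xi,w)$ for $(x,\Omega)$ with $-\infty<T^-_\Omega[\xi]$ and $T^+_\Omega[\xi]<\infty$. It is a local c-supersolution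 if for each $x\in\Omega$ there is $r>0$ with $B_r(x)\subset\Omega$ such that for every $\varepsilon>0$ there is an $\varepsilon$-good pair for $(x,B_r(x))$. A continuous $u$ is a c-solution (local c-solution) if it is a c-subsolution and a c-supersolution (local c-supersolution). *Slope-based solutions.* Let $\overline{\mathcal C}(\Omega)$ (resp. $\underline{\mathcal C}(\Omega)$) be the set of locally Lipschitz $\psi$ on $\Omega$ with $|\nabla^+\psi|=|\nabla\psi|$ (resp. $|\nabla^-\psi|=|\nabla\psi|$) and $|\nabla\psi|$ continuous in $\Omega$. An upper (resp. lower) semicontinuous $u$ is an s-subsolution (resp. s-supersolution) if $|\nabla\psi_1|(x)\le f(x)+|\nabla\psi_2|^*(x)$ (resp. $|\nabla\psi_1|(x)\ge f(x)-|\nabla\psi_2|^*(x)$) whenever $\psi_1\in\underline{\mathcal C}(\Omega)$ (resp. $\overline{\mathcal C}(\Omega)$), $\psi_2$ is locally Lipschitz on $\Omega$, and $u-\psi_1-\psi_2$ has a local maximum (resp. minimum) at $x\in\Omega$. A continuous $u$ is an s-solution if it is both. *Monge solutions.* $u$ is a Monge solution if it is locally Lipschitz in $\Omega$ and $|\nabla^-u|=f$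 in $\Omega$. -/

import Mathlib

open Set Filter Topology

noncomputable section

namespace MetricEikonal

/-- A geodesic space: any two points are joined by a curve, parametrized by arc length,
whose length is their distance. -/
def IsGeodesicSpace (X : Type*) [MetricSpace X] : Prop :=
  ∀ x y : X, ∃ γ : ℝ → X, γ 0 = x ∧ γ (dist x y) = y ∧
    ∀ s ∈ Icc 0 (dist x y), ∀ t ∈ Icc 0 (dist x y), dist (γ s) (γ t) = |s - t|

section Curves

variable {X : Type*} [MetricSpace X]

/-- Admissible curves `ξ : ℝ → X` with `ξ 0 = x`: the absolutely continuous curves with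
`|ξ'| ≤ 1` almost everywhere, that is, the 1-Lipschitz curves. -/
def IsAdmissible (x : X) (ξ : ℝ → X) : Prop :=
  LipschitzWith 1 ξ ∧ ξ 0 = x

/-- The exit time `inf {t ≥ 0 : ξ t ∉ O}`, equal to `+∞` if there is no such `t`. -/
def exitTime (O : Set X) (ξ : ℝ → X) : EReal :=
  sInf ((fun t : ℝ => (t : EReal)) '' {t : ℝ | 0 ≤ t ∧ ξ t ∉ O})

/-- The entrance time `sup {t ≤ 0 : ξ t ∉ O}`, equal to `-∞` if there is no such `t`. -/
def entranceTime (O : Set X) (ξ : ℝ → X) : EReal :=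
  sSup ((fun t : ℝ => (t : EReal)) '' {t : ℝ | t ≤ 0 ∧ ξ t ∉ O})

/-- The open interval of times between entrance into `O` and exit from `O`. -/
def timeInterval (O : Set X) (ξ : ℝ → X) : Set ℝ :=
  {t : ℝ | entranceTime O ξ < (t : EReal) ∧ (t : EReal) < exitTime O ξ}

/-- Curve-based subsolutions of `|∇u| = f` in `Ω`. -/
def IsCSubsolution (Ω : Set X) (f u : X → ℝ) : Prop :=
  UpperSemicontinuousOn u Ω ∧
    ∀ x ∈ Ω, ∀ ξ : ℝ → X, IsAdmissible x ξ → (∀ t, ξ t ∈ Ω) →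
      ∀ φ : ℝ → ℝ, ContDiff ℝ 1 φ → IsLocalMax (fun t => u (ξ t) - φ t) 0 →
        |deriv φ 0| ≤ f x

/-- The requirements on the pair `(ξ, w)` for a curve-based supersolution, with
base point `x`, accuracy `ε` and exit from the set `O`. -/
def IsSupersolutionPair (O : Set X) (f u : X → ℝ) (x : X) (ε : ℝ)
    (ξ : ℝ → X) (w : ℝ → ℝ) : Prop :=
  LowerSemicontinuousOn w (timeInterval O ξ) ∧
    w 0 = u x ∧
    (∀ t ∈ timeInterval O ξ, u (ξ t) - ε ≤ w t) ∧
    ∀ φ : ℝ → ℝ, ContDiff ℝ 1 φ → ∀ t₀ ∈ timeInterval O ξ,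
      IsLocalMinOn (fun t => w t - φ t) (timeInterval O ξ) t₀ →
        f (ξ t₀) - ε ≤ |deriv φ t₀|

/-- Curve-based supersolutions of `|∇u| = f` in `Ω`. -/
def IsCSupersolution (Ω : Set X) (f u : X → ℝ) : Prop :=
  LowerSemicontinuousOn u Ω ∧
    ∀ ε > 0, ∀ x ∈ Ω, ∃ (ξ : ℝ → X) (w : ℝ → ℝ), IsAdmissible x ξ ∧
      ⊥ < entranceTime Ω ξ ∧ exitTime Ω ξ < ⊤ ∧ IsSupersolutionPair Ω f u x ε ξ w

/-- Curve-based solutions (c-solutions) of `|∇u| = f` in `Ω`. -/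
def IsCSolution (Ω : Set X) (f u : X → ℝ) : Prop :=
  ContinuousOn u Ω ∧ IsCSubsolution Ω f u ∧ IsCSupersolution Ω f u

/-- Local curve-based supersolutions of `|∇u| = f` in `Ω`. -/
def IsLocalCSupersolution (Ω : Set X) (f u : X → ℝ) : Prop :=
  LowerSemicontinuousOn u Ω ∧
    ∀ x ∈ Ω, ∃ r > 0, Metric.ball x r ⊆ Ω ∧
      ∀ ε > 0, ∃ (ξ : ℝ → X) (w : ℝ → ℝ), IsAdmissible x ξ ∧
        IsSupersolutionPair (Metric.ball x r) f u x ε ξ w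

/-- Local curve-based solutions (local c-solutions) of `|∇u| = f` in `Ω`. -/
def IsLocalCSolution (Ω : Set X) (f u : X → ℝ) : Prop :=
  ContinuousOn u Ω ∧ IsCSubsolution Ω f u ∧ IsLocalCSupersolution Ω f u

end Curves

section Slopes

open scoped ENNReal

variable {X : Type*} [MetricSpace X]

/-- The local slope `|∇u|(x) = limsup_{y → x} |u y - u x| / d(x, y)`. It takes values in
`[0, ∞]`, is finite where `u` is locally Lipschitz, and is `0` at an isolated point. -/
def localSlope (u : X → ℝ) (x : X) : ℝ≥0∞ :=
  limsup (fun y => ENNReal.ofReal (|u y - u x| / dist x y)) (𝓝[≠] x)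

/-- The super-slope `|∇⁺u|(x) = limsup_{y → x} max (u y - u x) 0 / d(x, y)`. -/
def superSlope (u : X → ℝ) (x : X) : ℝ≥0∞ :=
  limsup (fun y => ENNReal.ofReal (max (u y - u x) 0 / dist x y)) (𝓝[≠] x)

/-- The sub-slope `|∇⁻u|(x) = limsup_{y → x} max (u x - u y) 0 / d(x, y)`. -/
def subSlope (u : X → ℝ) (x : X) : ℝ≥0∞ :=
  limsup (fun y => ENNReal.ofReal (max (u x - u y) 0 / dist x y)) (𝓝[≠] x)

/-- The upper semicontinuous envelope `|∇ψ|^*(x) = limsup_{y → x} |∇ψ|(y)`. -/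
def localSlopeEnvelope (ψ : X → ℝ) (x : X) : ℝ≥0∞ :=
  limsup (localSlope ψ) (𝓝 x)

/-- The test class of locally Lipschitz `ψ` with `|∇⁺ψ| = |∇ψ|` continuous in `Ω`. -/
def UpperTestClass (Ω : Set X) : Set (X → ℝ) :=
  {ψ | LocallyLipschitzOn Ω ψ ∧ (∀ x ∈ Ω, superSlope ψ x = localSlope ψ x) ∧
    ContinuousOn (localSlope ψ) Ω}

/-- The test class of locally Lipschitz `ψ` with `|∇⁻ψ| = |∇ψ|` continuous in `Ω`. -/
def LowerTestClass (Ω : Set X) : Set (X → ℝ) :=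
  {ψ | LocallyLipschitzOn Ω ψ ∧ (∀ x ∈ Ω, subSlope ψ x = localSlope ψ x) ∧
    ContinuousOn (localSlope ψ) Ω}

/-- Slope-based subsolutions of `|∇u| = f` in `Ω`, for `f ≥ 0`:
`|∇ψ₁|(x) ≤ f x + |∇ψ₂|^*(x)` at local maxima `x` of `u - ψ₁ - ψ₂`. -/
def IsSSubsolution (Ω : Set X) (f u : X → ℝ) : Prop :=
  UpperSemicontinuousOn u Ω ∧
    ∀ ψ₁ ∈ LowerTestClass Ω, ∀ ψ₂ : X → ℝ, LocallyLipschitzOn Ω ψ₂ → ∀ x ∈ Ω,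
      IsLocalMaxOn (fun y => u y - ψ₁ y - ψ₂ y) Ω x →
        localSlope ψ₁ x ≤ ENNReal.ofReal (f x) + localSlopeEnvelope ψ₂ x

/-- Slope-based supersolutions of `|∇u| = f` in `Ω`, for `f ≥ 0`:
`|∇ψ₁|(x) ≥ f x - |∇ψ₂|^*(x)` at local minima `x` of `u - ψ₁ - ψ₂`. The truncation of the
difference at `0` is harmless because the left-hand side is nonnegative. -/
def IsSSupersolution (Ω : Set X) (f u : X → ℝ) : Prop :=
  LowerSemicontinuousOn u Ω ∧
    ∀ ψ₁ ∈ UpperTestClass Ω, ∀ ψ₂ : X → ℝ, LocallyLipschitzOn Ω ψ₂ → ∀ x ∈ Ω,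
      IsLocalMinOn (fun y => u y - ψ₁ y - ψ₂ y) Ω x →
        ENNReal.ofReal (f x) - localSlopeEnvelope ψ₂ x ≤ localSlope ψ₁ x

/-- Slope-based solutions (s-solutions) of `|∇u| = f` in `Ω`. -/
def IsSSolution (Ω : Set X) (f u : X → ℝ) : Prop :=
  ContinuousOn u Ω ∧ IsSSubsolution Ω f u ∧ IsSSupersolution Ω f u

/-- Monge subsolutions of `|∇u| = f` in `Ω`, for `f ≥ 0`. -/
def IsMongeSubsolution (Ω : Set X) (f u : X → ℝ) : Prop :=
  LocallyLipschitzOn Ω u ∧ ∀ x ∈ Ω, subSlope u x ≤ ENNReal.ofReal (f x)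

/-- Monge supersolutions of `|∇u| = f` in `Ω`, for `f ≥ 0`. -/
def IsMongeSupersolution (Ω : Set X) (f u : X → ℝ) : Prop :=
  LocallyLipschitzOn Ω u ∧ ∀ x ∈ Ω, ENNReal.ofReal (f x) ≤ subSlope u x

/-- Monge solutions of `|∇u| = f` in `Ω`. -/
def IsMongeSolution (Ω : Set X) (f u : X → ℝ) : Prop :=
  IsMongeSubsolution Ω f u ∧ IsMongeSupersolution Ω f u

end Slopes

end MetricEikonal

end

/-! Every notion of solution splits into two halves. The upper half is `HasLipschitzBound`: near
`x₀`, `u` is Lipschitz with any constant above `f x₀`. The lower half is `f ≤ |∇⁻u|`. Together they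
give `f ≤ |∇⁻u| ≤ |∇u| ≤ f`, hence the Monge property and the equality of slopes.

Upper half: if `u y - u x` exceeds `M d(x,y)` with `M > f`, subtracting a function of slope about
`M` (linear along a geodesic for curves, a smoothed cone for slopes) leaves an interior maximum,
where the subsolution test fails (the two lemmas `hasLipschitzBound`). Conversely, `|∇⁻u| ≤ f`
passes both tests directly.

Lower half: if `|∇⁻u|(x) < k < f x`, then `u` lies above a downward cone of slope `k` at `x`. Adding
a slightly steeper smoothed cone creates an interior minimum where the test slope is below `f`,
against the supersolution property (the two lemmas `le_subSlope`). Conversely, s-supersolutions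
follow from subadditivity of slopes. For local c-supersolutions a curve of almost steepest descent
is built: by compactness `u` drops by about `f δ` from a point to some point at distance `δ`
(`exists_mem_sphere_descent`), such steps are iterated and joined by geodesics, and `w` is `u x`
minus the integral of `f - ε` along the curve, reflected evenly at time `0`. -/

namespace MetricEikonal

open scoped ENNReal

/-! ### One-sided derivative tests and a smoothed absolute value. -/

section OneVariable

theorem HasDerivAt.nonneg_of_eventually_right {h : ℝ → ℝ} {D a : ℝ} (hd : HasDerivAt h D a)
    (hmin : ∀ᶠ t in 𝓝[>] a, h a ≤ h t) : 0 ≤ D := by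
  have h1 : Tendsto (slope h a) (𝓝[>] a) (𝓝 D) :=
    (hasDerivAt_iff_tendsto_slope.1 hd).mono_left
      (nhdsWithin_mono _ fun t (ht : a < t) => ht.ne')
  refine ge_of_tendsto h1 ?_
  filter_upwards [hmin, self_mem_nhdsWithin] with t ht hat
  rw [slope_def_field]
  exact div_nonneg (sub_nonneg.2 ht) (sub_nonneg.2 (le_of_lt hat))

theorem HasDerivAt.nonpos_of_eventually_left {h : ℝ → ℝ} {D a : ℝ} (hd : HasDerivAt h D a)
    (hmin : ∀ᶠ t in 𝓝[<] a, h a ≤ h t) : D ≤ 0 := by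
  have h1 : Tendsto (slope h a) (𝓝[<] a) (𝓝 D) :=
    (hasDerivAt_iff_tendsto_slope.1 hd).mono_left
      (nhdsWithin_mono _ fun t (ht : t < a) => ht.ne)
  refine le_of_tendsto h1 ?_
  filter_upwards [hmin, self_mem_nhdsWithin] with t ht hat
  rw [slope_def_field]
  exact div_nonpos_of_nonneg_of_nonpos (sub_nonneg.2 ht) (sub_nonpos.2 (le_of_lt hat))

/-- The smooth approximation `s ↦ M √(δ² + s²) + N s²` of `s ↦ M |s|`. -/
noncomputable def smoothAbs (M N δ s : ℝ) : ℝ := M * √(δ ^ 2 + s ^ 2) + N * s ^ 2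

/-- The derivative of `smoothAbs M N δ`. -/
noncomputable def smoothAbsDeriv (M N δ s : ℝ) : ℝ := M * (s / √(δ ^ 2 + s ^ 2)) + 2 * N * s

variable {M N δ : ℝ}

theorem smoothAbs_hasDerivAt (hδ : 0 < δ) (s : ℝ) :
    HasDerivAt (smoothAbs M N δ) (smoothAbsDeriv M N δ s) s := by
  have hpos : δ ^ 2 + s ^ 2 ≠ 0 := by positivity
  have h1 : HasDerivAt (fun s : ℝ => s ^ 2) (2 * s) s := by
    simpa using hasDerivAt_pow 2 s
  have h2 := ((h1.const_add (δ ^ 2)).sqrt hpos).const_mul M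
  refine (h2.add (h1.const_mul N)).congr_deriv ?_
  unfold smoothAbsDeriv
  field_simp

theorem continuous_smoothAbsDeriv (hδ : 0 < δ) : Continuous (smoothAbsDeriv M N δ) := by
  unfold smoothAbsDeriv
  have : ∀ s : ℝ, √(δ ^ 2 + s ^ 2) ≠ 0 := fun s => by positivity
  fun_prop (disch := assumption)

theorem contDiff_smoothAbs (hδ : 0 < δ) : ContDiff ℝ 1 (smoothAbs M N δ) := by
  rw [contDiff_one_iff_deriv]
  refine ⟨fun s => (smoothAbs_hasDerivAt hδ s).differentiableAt, ?_⟩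
  rw [show deriv (smoothAbs M N δ) = smoothAbsDeriv M N δ from
    funext fun s => (smoothAbs_hasDerivAt hδ s).deriv]
  exact continuous_smoothAbsDeriv hδ

@[simp] theorem smoothAbsDeriv_zero : smoothAbsDeriv M N δ 0 = 0 := by
  simp [smoothAbsDeriv]

theorem smoothAbsDeriv_nonneg (hM : 0 ≤ M) (hN : 0 ≤ N) {s : ℝ} (hs : 0 ≤ s) :
    0 ≤ smoothAbsDeriv M N δ s := by
  unfold smoothAbsDeriv; positivity

theorem abs_le_sqrt_sq_add_sq (δ s : ℝ) : |s| ≤ √(δ ^ 2 + s ^ 2) :=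
  Real.abs_le_sqrt (by nlinarith [sq_nonneg δ])

theorem smoothAbs_zero (hδ : 0 < δ) : smoothAbs M N δ 0 = M * δ := by
  simp [smoothAbs, Real.sqrt_sq hδ.le]

theorem le_smoothAbs (hM : 0 ≤ M) (s : ℝ) : M * |s| + N * s ^ 2 ≤ smoothAbs M N δ s := by
  unfold smoothAbs
  gcongr
  exact abs_le_sqrt_sq_add_sq δ s

theorem smoothAbs_le (hM : 0 ≤ M) (hδ : 0 < δ) {s : ℝ} (hs : 0 ≤ s) :
    smoothAbs M N δ s ≤ M * (δ + s) + N * s ^ 2 := by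
  unfold smoothAbs
  gcongr
  rw [Real.sqrt_le_left (by positivity)]
  nlinarith [mul_nonneg hδ.le hs]

theorem abs_div_sqrt_le_one (δ s : ℝ) : |s / √(δ ^ 2 + s ^ 2)| ≤ 1 := by
  rw [abs_div, abs_of_nonneg (Real.sqrt_nonneg _)]
  exact div_le_one_of_le₀ (abs_le_sqrt_sq_add_sq δ s) (Real.sqrt_nonneg _)

theorem smoothAbsDeriv_le (hM : 0 ≤ M) (s : ℝ) :
    smoothAbsDeriv M N δ s ≤ M + 2 * N * s := by
  unfold smoothAbsDeriv
  have := (le_abs_self _).trans (abs_div_sqrt_le_one δ s)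
  nlinarith

/-- Condition `hsmall` is `m √(δ² + η²) < M η` squared, and it persists when `η` is replaced by a
larger `s`. -/
theorem lt_smoothAbsDeriv {m η s : ℝ} (hm : 0 < m) (hmM : m < M) (hN : 0 ≤ N) (hδ : 0 < δ)
    (hη : 0 < η) (hsmall : m ^ 2 * δ ^ 2 < (M ^ 2 - m ^ 2) * η ^ 2) (hs : η ≤ s) :
    m < smoothAbsDeriv M N δ s := by
  have hs0 : 0 < s := hη.trans_le hs
  have h1 : m * √(δ ^ 2 + s ^ 2) < M * s := by
    refine lt_of_pow_lt_pow_left₀ 2 (by nlinarith) ?_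
    rw [mul_pow, mul_pow, Real.sq_sqrt (by positivity)]
    have h2 : η ^ 2 ≤ s ^ 2 := by gcongr
    have h3 : 0 ≤ M ^ 2 - m ^ 2 := by nlinarith
    nlinarith [mul_le_mul_of_nonneg_left h2 h3]
  have h4 : m < M * (s / √(δ ^ 2 + s ^ 2)) := by
    rw [← mul_div_assoc, lt_div_iff₀ (by positivity)]
    exact h1
  unfold smoothAbsDeriv
  have : 0 ≤ 2 * N * s := by positivity
  linarith

end OneVariable

/-! ### Bounds for slopes and their subadditivity. -/

section SlopeBounds

variable {X : Type*} [MetricSpace X] {u v ψ : X → ℝ} {x : X} {c : ℝ}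

theorem limsup_quotient_le {g : X → ℝ}
    (h : ∀ᶠ y in 𝓝 x, g y ≤ c * dist x y) :
    limsup (fun y => ENNReal.ofReal (g y / dist x y)) (𝓝[≠] x) ≤ ENNReal.ofReal c := by
  refine limsup_le_of_le (by isBoundedDefault) ?_
  filter_upwards [h.filter_mono nhdsWithin_le_nhds, self_mem_nhdsWithin] with y hy hne
  exact ENNReal.ofReal_le_ofReal ((div_le_iff₀ (dist_pos.2 (Ne.symm hne))).2 hy)

/-- The strict inequality together with `g x ≤ 0` excludes `y = x`, so nothing is lost in passing to
the punctured neighbourhood. -/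
theorem le_limsup_quotient {g : X → ℝ} (hx : g x ≤ 0)
    (h : ∃ᶠ y in 𝓝 x, c * dist x y < g y) :
    ENNReal.ofReal c ≤ limsup (fun y => ENNReal.ofReal (g y / dist x y)) (𝓝[≠] x) := by
  refine le_limsup_of_frequently_le ?_ (by isBoundedDefault)
  rw [frequently_nhdsWithin_iff]
  refine h.mono fun y hy => ?_
  have hne : y ≠ x := by
    rintro rfl
    rw [dist_self, mul_zero] at hy
    exact hy.not_ge hx
  exact ⟨ENNReal.ofReal_le_ofReal ((le_div_iff₀ (dist_pos.2 hne.symm)).2 hy.le), hne⟩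

theorem subSlope_le (hc : 0 ≤ c) (h : ∀ᶠ y in 𝓝 x, u x - u y ≤ c * dist x y) :
    subSlope u x ≤ ENNReal.ofReal c :=
  limsup_quotient_le (h.mono fun _ hy => max_le hy (by positivity))

theorem localSlope_le (h : ∀ᶠ y in 𝓝 x, |u y - u x| ≤ c * dist x y) :
    localSlope u x ≤ ENNReal.ofReal c :=
  limsup_quotient_le h

theorem le_subSlope (h : ∃ᶠ y in 𝓝 x, c * dist x y < u x - u y) :
    ENNReal.ofReal c ≤ subSlope u x :=
  le_limsup_quotient (by simp) (h.mono fun _ hy => hy.trans_le (le_max_left _ _))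

theorem eventually_of_subSlope_lt (h : subSlope u x < ENNReal.ofReal c) :
    ∀ᶠ y in 𝓝 x, u x - u y ≤ c * dist x y := by
  by_contra hcon
  rw [not_eventually] at hcon
  exact h.not_ge (le_subSlope (hcon.mono fun _ hy => not_le.1 hy))

theorem subSlope_le_localSlope (u : X → ℝ) (x : X) : subSlope u x ≤ localSlope u x := by
  refine limsup_le_limsup (Eventually.of_forall fun y => ENNReal.ofReal_le_ofReal ?_)
  gcongr
  exact max_le (by rw [abs_sub_comm]; exact le_abs_self _) (abs_nonneg _)

theorem localSlope_neg (u : X → ℝ) (x : X) : localSlope (fun y => -u y) x = localSlope u x := by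
  unfold localSlope
  congr with y
  rw [← abs_neg (u y - u x)]
  ring_nf

theorem superSlope_neg (u : X → ℝ) (x : X) : superSlope (fun y => -u y) x = subSlope u x := by
  unfold superSlope subSlope
  congr with y
  ring_nf

theorem localSlope_le_envelope (ψ : X → ℝ) (x : X) :
    localSlope ψ x ≤ localSlopeEnvelope ψ x :=
  le_limsup_of_frequently_le
    (frequently_iff.2 fun hU => ⟨x, mem_of_mem_nhds hU, le_rfl⟩) (by isBoundedDefault)

theorem localSlopeEnvelope_zero (x : X) : localSlopeEnvelope (fun _ : X => (0 : ℝ)) x = 0 := by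
  have h : localSlope (fun _ : X => (0 : ℝ)) = fun _ => 0 := by
    funext y
    refine le_antisymm ?_ zero_le
    simpa using localSlope_le (c := 0) (u := fun _ : X => (0 : ℝ)) (x := y) (by simp)
  rw [localSlopeEnvelope, h]
  simp

theorem limsup_add_le_add {α : Type*} {l : Filter α} (a b : α → ℝ≥0∞) :
    limsup (fun y => a y + b y) l ≤ limsup a l + limsup b l := by
  refine ENNReal.le_of_forall_pos_le_add fun ε hε htop => ?_
  obtain ⟨ha, hb⟩ := ENNReal.add_lt_top.1 htop
  have hε2 : (ε / 2 : ℝ≥0∞) ≠ 0 := by simp [hε.ne']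
  refine limsup_le_of_le (by isBoundedDefault) ?_
  filter_upwards [eventually_lt_of_limsup_lt (ENNReal.lt_add_right ha.ne hε2),
    eventually_lt_of_limsup_lt (ENNReal.lt_add_right hb.ne hε2)] with y hy1 hy2
  refine (add_le_add hy1.le hy2.le).trans_eq ?_
  rw [add_add_add_comm, ENNReal.add_halves]

theorem limsup_quotient_le_add {g g₁ g₂ : X → ℝ} (h₁ : ∀ y, 0 ≤ g₁ y) (h₂ : ∀ y, 0 ≤ g₂ y)
    (h : ∀ᶠ y in 𝓝 x, g y ≤ g₁ y + g₂ y) :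
    limsup (fun y => ENNReal.ofReal (g y / dist x y)) (𝓝[≠] x) ≤
      limsup (fun y => ENNReal.ofReal (g₁ y / dist x y)) (𝓝[≠] x) +
        limsup (fun y => ENNReal.ofReal (g₂ y / dist x y)) (𝓝[≠] x) := by
  refine (limsup_le_limsup ?_).trans (limsup_add_le_add _ _)
  filter_upwards [h.filter_mono nhdsWithin_le_nhds] with y hy
  rw [← ENNReal.ofReal_add (div_nonneg (h₁ y) dist_nonneg) (div_nonneg (h₂ y) dist_nonneg),
    ← add_div]
  exact ENNReal.ofReal_le_ofReal (by gcongr)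

/-- Meant for a local maximum of `v - u - ψ`: here `u` plays the test function and `v` the
subsolution. -/
theorem subSlope_le_add (h : ∀ᶠ y in 𝓝 x, u x - u y ≤ (v x - v y) + (ψ y - ψ x)) :
    subSlope u x ≤ subSlope v x + localSlope ψ x := by
  refine limsup_quotient_le_add (fun y => le_max_right _ _) (fun y => abs_nonneg _) ?_
  filter_upwards [h] with y hy
  exact max_le (hy.trans (add_le_add (le_max_left _ _) (le_abs_self _)))
    (add_nonneg (le_max_right _ _) (abs_nonneg _))

theorem subSlope_le_localSlope_add
    (h : ∀ᶠ y in 𝓝 x, u x - u y ≤ -(v y - v x) - (ψ y - ψ x)) :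
    subSlope u x ≤ localSlope v x + localSlope ψ x := by
  refine limsup_quotient_le_add (fun y => abs_nonneg _) (fun y => abs_nonneg _) ?_
  filter_upwards [h] with y hy
  refine max_le (hy.trans ?_) (by positivity)
  rw [sub_eq_add_neg]
  exact add_le_add (neg_le_abs _) (neg_le_abs _)

end SlopeBounds

/-! ### Functions of the distance to a point, and their slopes. -/

section RadialFunctions

variable {X : Type*} [MetricSpace X]

/-- Clamping the parameter to `[0, d(x,y)]` extends the geodesic to all of `ℝ`, constant beyond both
ends, without spoiling the Lipschitz constant. -/
theorem IsGeodesicSpace.exists_curve (hX : IsGeodesicSpace X) (x y : X) :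
    ∃ ξ : ℝ → X, LipschitzWith 1 ξ ∧ ξ 0 = x ∧ (∀ t, dist x y ≤ t → ξ t = y) ∧
      (∀ t, dist x (ξ t) ≤ dist x y) ∧
      ∀ t ∈ Icc 0 (dist x y), dist x (ξ t) = t ∧ dist (ξ t) y = dist x y - t := by
  obtain ⟨γ, h0, h1, hγ⟩ := hX x y
  have hL : (0 : ℝ) ≤ dist x y := dist_nonneg
  set L := dist x y with hLdef
  have hmem : ∀ t : ℝ, max 0 (min t L) ∈ Icc 0 L := fun t =>
    ⟨le_max_left _ _, max_le hL (min_le_right _ _)⟩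
  have hclamp : ∀ t ∈ Icc 0 L, max 0 (min t L) = t := fun t ht => by
    rw [min_eq_left ht.2, max_eq_right ht.1]
  refine ⟨fun t => γ (max 0 (min t L)), ?_, ?_, ?_, ?_, ?_⟩
  · refine LipschitzWith.of_dist_le_mul fun s t => ?_
    rw [hγ _ (hmem s) _ (hmem t), NNReal.coe_one, one_mul, Real.dist_eq]
    refine (abs_max_sub_max_le_max _ _ _ _).trans ?_
    rw [sub_self, abs_zero]
    refine max_le (abs_nonneg _) ((abs_min_sub_min_le_max _ _ _ _).trans ?_)
    rw [sub_self, abs_zero]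
    exact max_le le_rfl (abs_nonneg _)
  · simp only [hclamp 0 ⟨le_rfl, hL⟩, h0]
  · intro t ht
    simp only [min_eq_right ht, max_eq_right hL, h1]
  · intro t
    have h := hγ 0 ⟨le_rfl, hL⟩ _ (hmem t)
    rw [h0] at h
    rw [h, zero_sub, abs_neg, abs_of_nonneg (hmem t).1]
    exact (hmem t).2
  · intro t ht
    simp only [hclamp t ht]
    constructor
    · have h := hγ 0 ⟨le_rfl, hL⟩ t ht
      rwa [h0, zero_sub, abs_neg, abs_of_nonneg ht.1] at h
    · have h := hγ t ht L ⟨hL, le_rfl⟩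
      rwa [h1, abs_sub_comm, abs_of_nonneg (sub_nonneg.2 ht.2)] at h

variable {φ φ' : ℝ → ℝ}

theorem localSlope_radial_le (hφ : ∀ s, HasDerivAt φ (φ' s) s) (hpos : ∀ s, 0 ≤ s → 0 ≤ φ' s)
    (x y : X) : localSlope (fun z => φ (dist x z)) y ≤ ENNReal.ofReal (φ' (dist x y)) := by
  have h0 : 0 ≤ φ' (dist x y) := hpos _ dist_nonneg
  refine ENNReal.le_of_forall_pos_le_add fun ε hε _ => ?_
  rw [← ENNReal.ofReal_coe_nnreal, ← ENNReal.ofReal_add h0 ε.coe_nonneg]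
  refine localSlope_le ?_
  have h1 := (hasDerivAt_iff_isLittleO.1 (hφ (dist x y))).def (NNReal.coe_pos.2 hε)
  have h2 : Tendsto (fun z => dist x z) (𝓝 y) (𝓝 (dist x y)) :=
    (continuous_const.dist continuous_id).tendsto y
  filter_upwards [h2.eventually h1] with z hz
  have h3 : |dist x z - dist x y| ≤ dist y z := by
    have := abs_dist_sub_le z y x
    rwa [dist_comm z x, dist_comm y x, dist_comm z y] at this
  rw [Real.norm_eq_abs, Real.norm_eq_abs, smul_eq_mul] at hz
  calc |φ (dist x z) - φ (dist x y)|
      ≤ |φ (dist x z) - φ (dist x y) - (dist x z - dist x y) * φ' (dist x y)|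
        + |(dist x z - dist x y) * φ' (dist x y)| := by
        have := abs_add_le (φ (dist x z) - φ (dist x y) - (dist x z - dist x y) * φ' (dist x y))
          ((dist x z - dist x y) * φ' (dist x y))
        simpa using this
    _ ≤ ε * |dist x z - dist x y| + |dist x z - dist x y| * φ' (dist x y) := by
        rw [abs_mul, abs_of_nonneg h0]
        gcongr
    _ = (φ' (dist x y) + ε) * |dist x z - dist x y| := by ring
    _ ≤ (φ' (dist x y) + ε) * dist y z := by gcongr

/-- Along a geodesic from `y` to `x` the distance to `x` decreases at unit speed. At `y = x` no
descent is possible, whence the condition `φ' 0 = 0`. -/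
theorem le_subSlope_radial (hX : IsGeodesicSpace X) (hφ : ∀ s, HasDerivAt φ (φ' s) s)
    (hzero : φ' 0 = 0) (x y : X) :
    ENNReal.ofReal (φ' (dist x y)) ≤ subSlope (fun z => φ (dist x z)) y := by
  rcases eq_or_ne x y with rfl | hxy
  · simp [hzero]
  by_contra! hlt
  obtain ⟨c, hc1, hc2⟩ := ENNReal.lt_iff_exists_nnreal_btwn.1 hlt
  rw [← ENNReal.ofReal_coe_nnreal] at hc1 hc2
  have hc2 : (c : ℝ) < φ' (dist x y) := (ENNReal.ofReal_lt_ofReal_iff').1 hc2 |>.1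
  obtain ⟨ξ, hξ, hξ0, -, -, hd⟩ := hX.exists_curve y x
  have hL : 0 < dist y x := dist_pos.2 hxy.symm
  have hlim : Tendsto ξ (𝓝[>] 0) (𝓝 y) := by
    have := hξ.continuous.tendsto 0
    rw [hξ0] at this
    exact this.mono_left nhdsWithin_le_nhds
  have hev := hlim.eventually (eventually_of_subSlope_lt hc1)
  have hder : HasDerivAt (fun t => φ (dist x y - t) + c * t) (-φ' (dist x y) + c) 0 := by
    have h1 : HasDerivAt (fun t : ℝ => dist x y - t) (-1) 0 := by
      simpa using (hasDerivAt_id (0 : ℝ)).const_sub (dist x y)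
    have h2 : HasDerivAt φ (φ' (dist x y)) (dist x y - 0) := by simpa using hφ (dist x y)
    have h3 := (h2.comp (0 : ℝ) h1).add ((hasDerivAt_id (0 : ℝ)).const_mul (c : ℝ))
    refine h3.congr_deriv ?_
    ring
  have := HasDerivAt.nonneg_of_eventually_right hder (by
    filter_upwards [hev, Ioo_mem_nhdsGT hL] with t ht htL
    obtain ⟨h1, h2⟩ := hd t ⟨htL.1.le, htL.2.le⟩
    rw [h1, dist_comm x (ξ t), h2, dist_comm y x] at ht
    simp only [sub_zero, mul_zero, add_zero]
    linarith)
  linarith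


theorem localSlope_radial (hX : IsGeodesicSpace X) (hφ : ∀ s, HasDerivAt φ (φ' s) s)
    (hzero : φ' 0 = 0) (hpos : ∀ s, 0 ≤ s → 0 ≤ φ' s) (x y : X) :
    localSlope (fun z => φ (dist x z)) y = ENNReal.ofReal (φ' (dist x y)) :=
  (localSlope_radial_le hφ hpos x y).antisymm
    ((le_subSlope_radial hX hφ hzero x y).trans (subSlope_le_localSlope _ _))

theorem subSlope_radial (hX : IsGeodesicSpace X) (hφ : ∀ s, HasDerivAt φ (φ' s) s)
    (hzero : φ' 0 = 0) (hpos : ∀ s, 0 ≤ s → 0 ≤ φ' s) (x y : X) :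
    subSlope (fun z => φ (dist x z)) y = ENNReal.ofReal (φ' (dist x y)) :=
  ((subSlope_le_localSlope _ _).trans (localSlope_radial_le hφ hpos x y)).antisymm
    (le_subSlope_radial hX hφ hzero x y)

theorem locallyLipschitz_radial (hφ : ContDiff ℝ 1 φ) (x : X) :
    LocallyLipschitz fun z => φ (dist x z) :=
  hφ.locallyLipschitz.comp (LipschitzWith.dist_right x).locallyLipschitz

variable {M N δ : ℝ}

theorem localSlope_smoothAbs_dist (hX : IsGeodesicSpace X) (hM : 0 ≤ M) (hN : 0 ≤ N)
    (hδ : 0 < δ) (x y : X) : localSlope (fun z => smoothAbs M N δ (dist x z)) y =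
      ENNReal.ofReal (smoothAbsDeriv M N δ (dist x y)) :=
  localSlope_radial hX (smoothAbs_hasDerivAt hδ) smoothAbsDeriv_zero
    (fun _ => smoothAbsDeriv_nonneg hM hN) x y

theorem continuous_localSlope_smoothAbs_dist (hX : IsGeodesicSpace X) (hM : 0 ≤ M)
    (hN : 0 ≤ N) (hδ : 0 < δ) (x : X) :
    Continuous (localSlope fun z => smoothAbs M N δ (dist x z)) := by
  rw [funext (localSlope_smoothAbs_dist hX hM hN hδ x)]
  exact ENNReal.continuous_ofReal.comp
    ((continuous_smoothAbsDeriv hδ).comp (continuous_const.dist continuous_id))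

/-- The cone `d(x,·)` itself may fail at its vertex, a minimum, where the sub-slope vanishes;
rounding it off there repairs this. -/
theorem smoothAbs_dist_mem_lowerTestClass (hX : IsGeodesicSpace X) (hM : 0 ≤ M) (hN : 0 ≤ N)
    (hδ : 0 < δ) (Ω : Set X) (x : X) :
    (fun z => smoothAbs M N δ (dist x z)) ∈ LowerTestClass Ω := by
  refine ⟨(locallyLipschitz_radial (contDiff_smoothAbs hδ) x).locallyLipschitzOn,
    fun y _ => ?_, (continuous_localSlope_smoothAbs_dist hX hM hN hδ x).continuousOn⟩
  rw [localSlope_smoothAbs_dist hX hM hN hδ]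
  exact subSlope_radial hX (smoothAbs_hasDerivAt hδ) smoothAbsDeriv_zero
    (fun _ => smoothAbsDeriv_nonneg hM hN) x y

theorem neg_smoothAbs_dist_mem_upperTestClass (hX : IsGeodesicSpace X) (hM : 0 ≤ M)
    (hN : 0 ≤ N) (hδ : 0 < δ) (Ω : Set X) (x : X) :
    (fun z => -smoothAbs M N δ (dist x z)) ∈ UpperTestClass Ω := by
  obtain ⟨-, h2, h3⟩ := smoothAbs_dist_mem_lowerTestClass hX hM hN hδ Ω x
  refine ⟨(locallyLipschitz_radial (contDiff_smoothAbs hδ).neg x).locallyLipschitzOn,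
    fun y hy => ?_, ?_⟩
  · rw [superSlope_neg, localSlope_neg]
    exact h2 y hy
  · rw [funext (localSlope_neg _)]
    exact h3

end RadialFunctions

/-! ### Times between entrance and exit. -/

section TimeInterval

variable {X : Type*} {O O' : Set X} {ξ : ℝ → X} {t : ℝ}

theorem isOpen_timeInterval [MetricSpace X] (O : Set X) (ξ : ℝ → X) :
    IsOpen (timeInterval O ξ) :=
  (isOpen_Ioo (a := entranceTime O ξ) (b := exitTime O ξ)).preimage continuous_coe_real_ereal

theorem timeInterval_mono [MetricSpace X] (h : O ⊆ O') :
    timeInterval O ξ ⊆ timeInterval O' ξ := fun _ ht =>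
  ⟨(sSup_le_sSup (image_mono fun _ hs => And.imp_right (mt fun hO => h hO) hs)).trans_lt ht.1,
    ht.2.trans_le (sInf_le_sInf (image_mono fun _ hs => And.imp_right (mt fun hO => h hO) hs))⟩

theorem mem_of_mem_timeInterval [MetricSpace X] (ht : t ∈ timeInterval O ξ) {s : ℝ}
    (hs : s ∈ uIcc 0 t) : ξ s ∈ O := by
  by_contra hO
  rcases le_total 0 t with h | h
  · rw [uIcc_of_le h] at hs
    have h1 : exitTime O ξ ≤ (s : EReal) := sInf_le ⟨s, ⟨hs.1, hO⟩, rfl⟩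
    exact (ht.2.trans_le h1).not_ge (EReal.coe_le_coe_iff.2 hs.2)
  · rw [uIcc_of_ge h] at hs
    have h1 : (s : EReal) ≤ entranceTime O ξ := le_sSup ⟨s, ⟨hs.2, hO⟩, rfl⟩
    exact (h1.trans_lt ht.1).not_ge (EReal.coe_le_coe_iff.2 hs.1)

theorem mem_timeInterval_of_forall_abs_lt [MetricSpace X] {r : ℝ}
    (h : ∀ s, |s| < r → ξ s ∈ O) (ht : |t| < r) : t ∈ timeInterval O ξ := by
  obtain ⟨h1, h2⟩ := abs_lt.1 ht
  constructor
  · refine lt_of_le_of_lt (sSup_le ?_) (EReal.coe_lt_coe_iff.2 h1)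
    rintro _ ⟨s, ⟨hs, hO⟩, rfl⟩
    refine EReal.coe_le_coe_iff.2 ?_
    have : r ≤ |s| := not_lt.1 fun hlt => hO (h s hlt)
    rw [abs_of_nonpos hs] at this
    linarith
  · refine lt_of_lt_of_le (EReal.coe_lt_coe_iff.2 h2) (le_sInf ?_)
    rintro _ ⟨s, ⟨hs, hO⟩, rfl⟩
    refine EReal.coe_le_coe_iff.2 ?_
    have : r ≤ |s| := not_lt.1 fun hlt => hO (h s hlt)
    rwa [abs_of_nonneg hs] at this

end TimeInterval

/-! ### Restriction of supersolution pairs, and local Lipschitz bounds. -/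

variable {X : Type*} [MetricSpace X] {Ω : Set X} {f u : X → ℝ}

theorem IsAdmissible.dist_le {x : X} {ξ : ℝ → X} (h : IsAdmissible x ξ) (t : ℝ) :
    dist x (ξ t) ≤ |t| := by
  have := h.1.dist_le_mul 0 t
  rwa [h.2, NNReal.coe_one, one_mul, Real.dist_eq, zero_sub, abs_neg] at this

/-- A smaller set has a smaller time interval, and since that interval is open, a local minimum on
it is an unrestricted one. -/
theorem IsSupersolutionPair.mono {O O' : Set X} {x : X} {ε : ℝ} {ξ : ℝ → X} {w : ℝ → ℝ}
    (hO : O ⊆ O') (h : IsSupersolutionPair O' f u x ε ξ w) :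
    IsSupersolutionPair O f u x ε ξ w := by
  have hI := timeInterval_mono (ξ := ξ) hO
  refine ⟨h.1.mono hI, h.2.1, fun t ht => h.2.2.1 t (hI ht), fun φ hφ t ht hmin => ?_⟩
  refine h.2.2.2 φ hφ t (hI ht) ?_
  have h1 : IsLocalMin (fun t => w t - φ t) t :=
    hmin.isLocalMin ((isOpen_timeInterval O ξ).mem_nhds ht)
  exact h1.on _

theorem IsCSolution.isLocalCSolution (hΩ : IsOpen Ω) (h : IsCSolution Ω f u) :
    IsLocalCSolution Ω f u := by
  refine ⟨h.1, h.2.1, h.2.2.1, fun x hx => ?_⟩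
  obtain ⟨r, hr, hball⟩ := Metric.isOpen_iff.1 hΩ x hx
  refine ⟨r, hr, hball, fun ε hε => ?_⟩
  obtain ⟨ξ, w, hξ, -, -, hw⟩ := h.2.2.2 ε hε x hx
  exact ⟨ξ, w, hξ, hw.mono hball⟩

/-- `u` is Lipschitz near each point of `Ω`, with any constant larger than the value of `f`. -/
def HasLipschitzBound (Ω : Set X) (f u : X → ℝ) : Prop :=
  ∀ x₀ ∈ Ω, ∀ M, f x₀ < M → ∃ ρ > 0, ∀ x ∈ Metric.ball x₀ ρ, ∀ y ∈ Metric.ball x₀ ρ,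
    u y - u x ≤ M * dist x y

theorem HasLipschitzBound.locallyLipschitzOn (hfpos : ∀ x ∈ Ω, 0 < f x)
    (h : HasLipschitzBound Ω f u) : LocallyLipschitzOn Ω u := by
  intro x hx
  obtain ⟨ρ, hρ, hb⟩ := h x hx (f x + 1) (by linarith)
  have hpos : 0 ≤ f x + 1 := by linarith [hfpos x hx]
  refine ⟨Real.toNNReal (f x + 1), Metric.ball x ρ, mem_nhdsWithin_of_mem_nhds
    (Metric.ball_mem_nhds x hρ), LipschitzOnWith.of_dist_le_mul fun y hy z hz => ?_⟩
  rw [Real.dist_eq, Real.coe_toNNReal _ hpos, abs_le]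
  have h1 := hb y hy z hz
  have h2 := hb z hz y hy
  rw [dist_comm] at h2
  constructor <;> linarith

theorem HasLipschitzBound.localSlope_le (hfpos : ∀ x ∈ Ω, 0 < f x)
    (h : HasLipschitzBound Ω f u) {x : X} (hx : x ∈ Ω) :
    localSlope u x ≤ ENNReal.ofReal (f x) := by
  refine ENNReal.le_of_forall_pos_le_add fun ε hε _ => ?_
  rw [← ENNReal.ofReal_coe_nnreal, ← ENNReal.ofReal_add (hfpos x hx).le ε.coe_nonneg]
  obtain ⟨ρ, hρ, hb⟩ := h x hx (f x + ε) (by simpa using hε)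
  refine MetricEikonal.localSlope_le ?_
  filter_upwards [Metric.ball_mem_nhds x hρ] with y hy
  have hxρ := Metric.mem_ball_self (x := x) hρ
  have h1 := hb x hxρ y hy
  have h2 := hb y hy x hxρ
  rw [dist_comm] at h2
  rw [abs_le]
  constructor <;> linarith

theorem exists_closedBall_subset {P : X → Prop} {x : X} (h : ∀ᶠ y in 𝓝 x, P y) :
    ∃ r > 0, ∀ y ∈ Metric.closedBall x r, P y := by
  obtain ⟨r, hr, hb⟩ := Metric.nhds_basis_closedBall.eventually_iff.1 h
  exact ⟨r, hr, fun y hy => hb hy⟩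

/-! ### Curve-based subsolutions. -/

theorem isCSubsolution_of_subSlope_le (hu : ContinuousOn u Ω) (hfpos : ∀ x ∈ Ω, 0 < f x)
    (h : ∀ x ∈ Ω, subSlope u x ≤ ENNReal.ofReal (f x)) : IsCSubsolution Ω f u := by
  refine ⟨hu.upperSemicontinuousOn, fun x hx ξ hξ _ φ hφ hmax => ?_⟩
  refine le_of_forall_gt_imp_ge_of_dense fun c hc => ?_
  have hc0 : 0 < c := (hfpos x hx).trans hc
  have hev := eventually_of_subSlope_lt ((h x hx).trans_lt
    ((ENNReal.ofReal_lt_ofReal_iff hc0).2 hc))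
  have hlim : Tendsto ξ (𝓝 0) (𝓝 x) := by
    simpa [hξ.2] using hξ.1.continuous.tendsto 0
  -- The sub-slope bound puts `u ∘ ξ` above `u x - c|t|` on both sides of `0`, so it alone controls
  -- both signs of `φ'`.
  have hφt : ∀ᶠ t in 𝓝 0, φ 0 ≤ φ t + c * |t| := by
    filter_upwards [hlim.eventually hev, hmax] with t h1 h2
    rw [hξ.2] at h2
    have := mul_le_mul_of_nonneg_left (hξ.dist_le t) hc0.le
    linarith
  have hd : HasDerivAt φ (deriv φ 0) 0 := (hφ.differentiable one_ne_zero 0).hasDerivAt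
  have hid : HasDerivAt (fun t : ℝ => c * t) c 0 := by
    simpa using (hasDerivAt_id (0 : ℝ)).const_mul c
  have h1 : 0 ≤ deriv φ 0 + c := HasDerivAt.nonneg_of_eventually_right (hd.add hid) (by
    filter_upwards [hφt.filter_mono nhdsWithin_le_nhds, self_mem_nhdsWithin] with t ht ht0
    rw [abs_of_pos ht0] at ht
    simpa using ht)
  have h2 : deriv φ 0 - c ≤ 0 := HasDerivAt.nonpos_of_eventually_left (hd.sub hid) (by
    filter_upwards [hφt.filter_mono nhdsWithin_le_nhds, self_mem_nhdsWithin] with t ht ht0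
    rw [abs_of_neg ht0] at ht
    simp
    linarith)
  exact abs_le.2 ⟨by linarith, by linarith⟩

theorem IsCSubsolution.hasLipschitzBound (hX : IsGeodesicSpace X) (hΩ : IsOpen Ω)
    (hf : ContinuousOn f Ω) (hfpos : ∀ x ∈ Ω, 0 < f x) (hu : ContinuousOn u Ω)
    (h : IsCSubsolution Ω f u) : HasLipschitzBound Ω f u := by
  intro x₀ hx₀ M hM
  have hnhds := hΩ.mem_nhds hx₀
  obtain ⟨R, hR, hball⟩ := exists_closedBall_subset
    (Filter.Eventually.and hnhds ((hf.continuousAt hnhds).eventually_lt_const hM))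
  refine ⟨R / 3, by positivity, fun x hx y hy => ?_⟩
  obtain ⟨ξ, hξ, hξ0, hξy, hξd, -⟩ := hX.exists_curve x y
  rw [Metric.mem_ball] at hx hy
  have hξR : ∀ t, ξ t ∈ Metric.closedBall x₀ R := fun t => by
    have h1 := dist_triangle x x₀ y
    have h2 := dist_triangle (ξ t) x x₀
    have h3 := hξd t
    rw [dist_comm x₀ y] at h1
    rw [dist_comm x (ξ t)] at h3
    rw [Metric.mem_closedBall]
    linarith
  have hM0 : 0 < M := (hfpos x₀ hx₀).trans hM
  have hcont : Continuous fun t => u (ξ t) - M * t :=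
    (hu.comp_continuous hξ.continuous fun t => (hball _ (hξR t)).1).sub
      (continuous_const.mul continuous_id)
  set L := dist x y
  have hL : 0 ≤ L := dist_nonneg
  -- The interval runs one unit past `L`: there the curve rests at `y` while `-M t` still decreases,
  -- so `L + 1` is not a maximiser.
  obtain ⟨t₁, ht₁, hmax⟩ := isCompact_Icc.exists_isMaxOn
    (nonempty_Icc.2 (by linarith : (0 : ℝ) ≤ L + 1)) hcont.continuousOn
  by_contra! hcon
  have hmaxL : u y - M * L ≤ u (ξ t₁) - M * t₁ := by
    have := isMaxOn_iff.1 hmax L ⟨hL, by linarith⟩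
    rwa [hξy L le_rfl] at this
  have h0 : t₁ ≠ 0 := by
    rintro rfl
    rw [hξ0] at hmaxL
    linarith
  have h1 : t₁ ≠ L + 1 := by
    rintro rfl
    rw [hξy _ (by linarith)] at hmaxL
    linarith
  have hloc : IsLocalMax (fun t => u (ξ t) - M * t) t₁ :=
    hmax.isLocalMax (Icc_mem_nhds (lt_of_le_of_ne ht₁.1 h0.symm) (lt_of_le_of_ne ht₁.2 h1))
  have hshift : IsLocalMax (fun t => u (ξ (t₁ + t)) - M * t) 0 := by
    have hlim : Tendsto (fun t => t₁ + t) (𝓝 0) (𝓝 t₁) := by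
      simpa using (continuous_const_add t₁).tendsto 0
    filter_upwards [hlim.eventually hloc] with t ht
    simp only [add_zero, mul_zero, sub_zero] at ht ⊢
    linarith
  have hadm : IsAdmissible (ξ t₁) fun t => ξ (t₁ + t) :=
    ⟨LipschitzWith.of_dist_le_mul fun s t => by
      simpa using hξ.dist_le_mul (t₁ + s) (t₁ + t), by simp⟩
  have := h.2 _ (hball _ (hξR t₁)).1 _ hadm (fun t => (hball _ (hξR _)).1) (fun t => M * t)
    (by fun_prop) hshift
  rw [deriv_const_mul_id', abs_of_pos hM0] at this
  linarith [(hball _ (hξR t₁)).2]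

/-! ### Slope-based sub- and supersolutions. -/

theorem isSSubsolution_of_subSlope_le (hΩ : IsOpen Ω) (hu : ContinuousOn u Ω)
    (h : ∀ x ∈ Ω, subSlope u x ≤ ENNReal.ofReal (f x)) : IsSSubsolution Ω f u := by
  refine ⟨hu.upperSemicontinuousOn, fun ψ₁ hψ₁ ψ₂ _ x hx hmax => ?_⟩
  rw [← hψ₁.2.1 x hx]
  refine (subSlope_le_add (v := u) (ψ := ψ₂) ?_).trans
    (add_le_add (h x hx) (localSlope_le_envelope ψ₂ x))
  filter_upwards [hmax.isLocalMax (hΩ.mem_nhds hx)] with y hy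
  linarith

theorem isSSupersolution_of_le_subSlope (hΩ : IsOpen Ω) (hu : ContinuousOn u Ω)
    (h : ∀ x ∈ Ω, ENNReal.ofReal (f x) ≤ subSlope u x) : IsSSupersolution Ω f u := by
  refine ⟨hu.lowerSemicontinuousOn, fun ψ₁ _ ψ₂ _ x hx hmin => ?_⟩
  refine tsub_le_iff_right.2 ((h x hx).trans
    ((subSlope_le_localSlope_add (v := ψ₁) (ψ := ψ₂) ?_).trans
      (by gcongr; exact localSlope_le_envelope ψ₂ x)))
  filter_upwards [hmin.isLocalMin (hΩ.mem_nhds hx)] with y hy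
  linarith

theorem IsSSubsolution.hasLipschitzBound [ProperSpace X] (hX : IsGeodesicSpace X)
    (hΩ : IsOpen Ω) (hf : ContinuousOn f Ω) (hfpos : ∀ x ∈ Ω, 0 < f x)
    (hu : ContinuousOn u Ω) (h : IsSSubsolution Ω f u) : HasLipschitzBound Ω f u := by
  intro x₀ hx₀ M hM
  have hnhds := hΩ.mem_nhds hx₀
  obtain ⟨m, hm, hmM⟩ := exists_between hM
  obtain ⟨M₁, hmM₁, hM₁⟩ := exists_between hmM
  have hm0 : 0 < m := (hfpos x₀ hx₀).trans hm
  have hM₁0 : 0 < M₁ := hm0.trans hmM₁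
  obtain ⟨R, hR, hball⟩ := exists_closedBall_subset
    (Filter.Eventually.and hnhds ((hf.continuousAt hnhds).eventually_lt_const hm))
  obtain ⟨B, hB⟩ := (isCompact_closedBall x₀ R).exists_bound_of_continuousOn
    (hu.mono fun y hy => (hball y hy).1)
  -- The oscillation of `u` is at most `2 B`; the term `N s²` beats it on the sphere of radius `R /
  -- 2` and keeps the maximiser inside.
  obtain ⟨N, hN⟩ := exists_gt (max 0 (2 * B / (R / 2) ^ 2))
  have hN0 : 0 < N := (le_max_left _ _).trans_lt hN
  have hNB : 2 * B < N * (R / 2) ^ 2 :=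
    (div_lt_iff₀ (by positivity)).1 ((le_max_right _ _).trans_lt hN)
  -- The second bound ensures `M₁ d + N d² ≤ M d` for `d = d(x,z)`, so the quadratic term fits into
  -- the gap between `M₁` and `M`.
  have hρ : 0 < min (R / 4) ((M - M₁) / (2 * N)) :=
    lt_min (by positivity) (div_pos (by linarith) (by positivity))
  refine ⟨_, hρ, fun x hx z hz => ?_⟩
  have hxR : dist x x₀ < R / 4 := hx.trans_le (min_le_left _ _)
  have hzx : dist x z < 2 * min (R / 4) ((M - M₁) / (2 * N)) := by
    rw [Metric.mem_ball] at hx hz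
    linarith [dist_triangle_right x z x₀]
  have hzR : dist x z < R / 2 := by linarith [min_le_left (R / 4) ((M - M₁) / (2 * N))]
  have hzM : N * dist x z ≤ M - M₁ := by
    have h1 : dist x z ≤ (M - M₁) / N := by
      have h2 := min_le_right (R / 4) ((M - M₁) / (2 * N))
      have h3 : 2 * ((M - M₁) / (2 * N)) = (M - M₁) / N := by field_simp
      linarith
    rw [le_div_iff₀ hN0] at h1
    linarith
  have hsub : Metric.closedBall x (R / 2) ⊆ Metric.closedBall x₀ R :=
    Metric.closedBall_subset_closedBall' (by linarith)
  have hxmem : x ∈ Metric.closedBall x (R / 2) := Metric.mem_closedBall_self (by positivity)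
  have hxΩ : x ∈ Ω := (hball x (hsub hxmem)).1
  by_contra! hcon
  obtain ⟨g, hg⟩ : ∃ g, g = u z - u x - M₁ * dist x z - N * dist x z ^ 2 := ⟨_, rfl⟩
  have hg0 : 0 < g := by
    have := mul_le_mul_of_nonneg_right hzM (dist_nonneg (x := x) (y := z))
    nlinarith
  -- The gain `g` at `z`, reduced by the smoothing error `M₁ δ < g / 2`, forces the maximiser out of
  -- the `η`-ball. Only there is the rounded cone steeper than `m`, so `η` has to be fixed before
  -- `δ`.
  obtain ⟨η, hη, hηu⟩ := exists_closedBall_subset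
    ((hu.continuousAt (hΩ.mem_nhds hxΩ)).eventually_lt_const (by linarith : u x < u x + g / 2))
  obtain ⟨δ, hδ, hδg, hδη⟩ : ∃ δ > 0, M₁ * δ < g / 2 ∧
      m ^ 2 * δ ^ 2 < (M₁ ^ 2 - m ^ 2) * η ^ 2 := by
    have h1 : ∀ᶠ δ in 𝓝[>] (0 : ℝ), M₁ * δ < g / 2 := by
      have : Tendsto (fun δ : ℝ => M₁ * δ) (𝓝 0) (𝓝 (M₁ * 0)) :=
        (continuous_const.mul continuous_id).tendsto 0
      exact (this.mono_left nhdsWithin_le_nhds).eventually_lt_const (by linarith)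
    have h2 : ∀ᶠ δ in 𝓝[>] (0 : ℝ), m ^ 2 * δ ^ 2 < (M₁ ^ 2 - m ^ 2) * η ^ 2 := by
      have : Tendsto (fun δ : ℝ => m ^ 2 * δ ^ 2) (𝓝 0) (𝓝 (m ^ 2 * 0 ^ 2)) :=
        (continuous_const.mul (continuous_id.pow 2)).tendsto 0
      refine (this.mono_left nhdsWithin_le_nhds).eventually_lt_const ?_
      have : 0 < M₁ ^ 2 - m ^ 2 := by nlinarith
      simp only [ne_eq, OfNat.ofNat_ne_zero, not_false_eq_true, zero_pow, mul_zero]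
      positivity
    obtain ⟨δ, ⟨h3, h4⟩, h5⟩ := ((h1.and h2).and self_mem_nhdsWithin).exists
    exact ⟨δ, h5, h3, h4⟩
  have hψc : Continuous fun y => smoothAbs M₁ N δ (dist x y) :=
    (contDiff_smoothAbs hδ).continuous.comp (continuous_const.dist continuous_id)
  obtain ⟨y, hy, hmax⟩ := (isCompact_closedBall x (R / 2)).exists_isMaxOn ⟨x, hxmem⟩
    ((hu.mono fun y hy => (hball y (hsub hy)).1).sub hψc.continuousOn)
  have hyz : u z - smoothAbs M₁ N δ (dist x z) ≤ u y - smoothAbs M₁ N δ (dist x y) :=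
    isMaxOn_iff.1 hmax z (by rw [Metric.mem_closedBall, dist_comm]; exact hzR.le)
  have hz' := smoothAbs_le (N := N) hM₁0.le hδ (dist_nonneg (x := x) (y := z))
  have hy' := le_smoothAbs (N := N) (δ := δ) hM₁0.le (dist x y)
  rw [abs_of_nonneg dist_nonneg] at hy'
  have hMd : 0 ≤ M₁ * dist x y := by positivity
  have hNd : 0 ≤ N * dist x y ^ 2 := by positivity
  have hbig : η ≤ dist x y := by
    by_contra! hlt
    have := hηu y (by rw [Metric.mem_closedBall, dist_comm]; exact hlt.le)
    linarith
  have hint : dist y x < R / 2 := by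
    refine lt_of_le_of_ne hy fun heq => ?_
    rw [dist_comm] at heq
    have h1 := abs_le.1 (hB y (hsub hy))
    have h2 := abs_le.1 (hB x (hsub hxmem))
    rw [heq] at hy' hMd hyz
    linarith
  have hyΩ := hball y (hsub hy)
  have hloc : IsLocalMax (fun y => u y - smoothAbs M₁ N δ (dist x y)) y :=
    hmax.isLocalMax (Metric.closedBall_mem_nhds_of_mem hint)
  have hslope := h.2 _ (smoothAbs_dist_mem_lowerTestClass hX hM₁0.le hN0.le hδ Ω x)
    (fun _ => 0) (LocallyLipschitz.const 0).locallyLipschitzOn y hyΩ.1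
    (by simpa using hloc.on Ω)
  rw [localSlope_smoothAbs_dist hX hM₁0.le hN0.le hδ, localSlopeEnvelope_zero, add_zero,
    ENNReal.ofReal_le_ofReal_iff (hfpos y hyΩ.1).le] at hslope
  linarith [lt_smoothAbsDeriv hm0 hmM₁ hN0.le hδ hη hδη hbig, hyΩ.2]

theorem IsSSupersolution.le_subSlope [ProperSpace X] (hX : IsGeodesicSpace X)
    (hΩ : IsOpen Ω) (hf : ContinuousOn f Ω)
    (hu : ContinuousOn u Ω) (h : IsSSupersolution Ω f u) {x : X} (hx : x ∈ Ω) :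
    ENNReal.ofReal (f x) ≤ subSlope u x := by
  by_contra! hlt
  obtain ⟨k, hk1, hk2⟩ := ENNReal.lt_iff_exists_nnreal_btwn.1 hlt
  rw [← ENNReal.ofReal_coe_nnreal] at hk1 hk2
  have hk2 : (k : ℝ) < f x := ((ENNReal.ofReal_lt_ofReal_iff').1 hk2).1
  obtain ⟨k₂, hkk₂, hk₂⟩ := exists_between hk2
  have hk0 : (0 : ℝ) ≤ k := k.coe_nonneg
  have hnhds := hΩ.mem_nhds hx
  obtain ⟨R, hR, hball⟩ := exists_closedBall_subset
    (Filter.Eventually.and hnhds (((hf.continuousAt hnhds).eventually_const_lt hk₂).and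
      (eventually_of_subSlope_lt hk1)))
  -- With `N = 1` the test slope on the `ρ`-ball is at most `k + 2ρ ≤ k₂ < f`; on its sphere the
  -- margin `ρ²` exceeds the value `k δ` at the vertex.
  obtain ⟨ρ, hρ0, hρ⟩ : ∃ ρ > 0, ρ ≤ R ∧ k + 2 * ρ ≤ k₂ :=
    ⟨min R ((k₂ - k) / 2), lt_min hR (by linarith), min_le_left _ _, by
      linarith [min_le_right R ((k₂ - k) / 2)]⟩
  have hsub : Metric.closedBall x ρ ⊆ Metric.closedBall x R :=
    Metric.closedBall_subset_closedBall hρ.1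
  obtain ⟨δ, hδ, hkδ⟩ : ∃ δ > 0, k * δ < ρ ^ 2 :=
    ⟨ρ ^ 2 / (k + 1), by positivity, by
      rw [← mul_div_assoc, div_lt_iff₀ (by positivity)]
      nlinarith [pow_pos hρ0 2]⟩
  have hψc : Continuous fun y => smoothAbs k 1 δ (dist x y) :=
    (contDiff_smoothAbs hδ).continuous.comp (continuous_const.dist continuous_id)
  have hxmem : x ∈ Metric.closedBall x ρ := Metric.mem_closedBall_self hρ0.le
  obtain ⟨y, hy, hmin⟩ := (isCompact_closedBall x ρ).exists_isMinOn ⟨x, hxmem⟩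
    ((hu.mono fun y hy => (hball y (hsub hy)).1).add hψc.continuousOn)
  obtain ⟨hyΩ, hyf, hyu⟩ := hball y (hsub hy)
  have hint : dist y x < ρ := by
    refine lt_of_le_of_ne hy fun heq => ?_
    rw [dist_comm] at heq
    have h1 : u y + smoothAbs k 1 δ (dist x y) ≤ u x + smoothAbs k 1 δ (dist x x) :=
      isMinOn_iff.1 hmin x hxmem
    have h2 := le_smoothAbs (N := 1) (δ := δ) hk0 (dist x y)
    rw [dist_self, smoothAbs_zero hδ] at h1
    rw [abs_of_nonneg dist_nonneg] at h2
    rw [heq] at h1 h2 hyu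
    linarith
  have hloc : IsLocalMin (fun y => u y + smoothAbs k 1 δ (dist x y)) y :=
    hmin.isLocalMin (Metric.closedBall_mem_nhds_of_mem hint)
  have hslope := h.2 _ (neg_smoothAbs_dist_mem_upperTestClass hX hk0 zero_le_one hδ Ω x)
    (fun _ => 0) (LocallyLipschitz.const 0).locallyLipschitzOn y hyΩ
    (by simpa using hloc.on Ω)
  rw [localSlope_neg, localSlope_smoothAbs_dist hX hk0 zero_le_one hδ,
    localSlopeEnvelope_zero, tsub_zero, ENNReal.ofReal_le_ofReal_iff
      (smoothAbsDeriv_nonneg hk0 zero_le_one dist_nonneg)] at hslope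
  have := smoothAbsDeriv_le (N := 1) (δ := δ) hk0 (dist x y)
  rw [dist_comm] at hint
  linarith

/-! ### Sub-slope bound from curve-based supersolutions. -/

theorem IsLocalCSupersolution.le_subSlope (hΩ : IsOpen Ω) (hf : ContinuousOn f Ω)
    (h : IsLocalCSupersolution Ω f u) {x : X} (hx : x ∈ Ω) :
    ENNReal.ofReal (f x) ≤ subSlope u x := by
  by_contra! hlt
  obtain ⟨k, hk1, hk2⟩ := ENNReal.lt_iff_exists_nnreal_btwn.1 hlt
  rw [← ENNReal.ofReal_coe_nnreal] at hk1 hk2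
  have hk2 : (k : ℝ) < f x := ((ENNReal.ofReal_lt_ofReal_iff').1 hk2).1
  obtain ⟨k₁, hkk₁, hk₁⟩ := exists_between hk2
  obtain ⟨k₂, hkk₂, hk₂⟩ := exists_between hk₁
  have hk0 : (0 : ℝ) ≤ k := k.coe_nonneg
  have hk₁0 : 0 < k₁ := hk0.trans_lt hkk₁
  obtain ⟨r, hr, -, hpair⟩ := h.2 x hx
  have hnhds := hΩ.mem_nhds hx
  obtain ⟨R, hR, hball⟩ := exists_closedBall_subset
    (((hf.continuousAt hnhds).eventually_const_lt hk₂).and (eventually_of_subSlope_lt hk1))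
  obtain ⟨ρ, hρ, hρR, hρr⟩ : ∃ ρ > 0, ρ ≤ R ∧ ρ < r :=
    ⟨min R (r / 2), lt_min hR (by positivity), min_le_left _ _,
      (min_le_right _ _).trans_lt (by linarith)⟩
  -- The gap `k₁ - k` absorbs the error in `w ≥ u ∘ ξ - ε` at times `±ρ`; the gap `k₂ - k₁` absorbs
  -- the one in `|φ'| ≥ f - ε`.
  obtain ⟨ε, hε, hε1, hε2⟩ : ∃ ε > 0, ε ≤ k₂ - k₁ ∧ ε < (k₁ - k) * ρ :=
    ⟨min (k₂ - k₁) ((k₁ - k) * ρ / 2),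
      lt_min (by linarith) (by have := mul_pos (sub_pos.2 hkk₁) hρ; linarith), min_le_left _ _,
      (min_le_right _ _).trans_lt (by have := mul_pos (sub_pos.2 hkk₁) hρ; linarith)⟩
  obtain ⟨ξ, w, hξ, hlsc, hw0, hwu, htest⟩ := hpair ε hε
  have hI : ∀ t, |t| ≤ ρ → t ∈ timeInterval (Metric.ball x r) ξ := fun t ht =>
    mem_timeInterval_of_forall_abs_lt (fun s hs => by
      rw [Metric.mem_ball, dist_comm]
      exact (hξ.dist_le s).trans_lt hs) (ht.trans_lt hρr)
  have hξR : ∀ t, |t| ≤ ρ → ξ t ∈ Metric.closedBall x R := fun t ht => by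
    rw [Metric.mem_closedBall, dist_comm]
    exact (hξ.dist_le t).trans (ht.trans hρR)
  have hdescent : ∀ t, |t| = ρ → u x < w t + k₁ * ρ := fun t ht => by
    have h1 := hwu t (hI t ht.le)
    have h2 := (hball _ (hξR t ht.le)).2
    have h3 := mul_le_mul_of_nonneg_left (hξ.dist_le t) hk0
    rw [ht] at h3
    nlinarith
  obtain ⟨g, hg0, hgl, hgr⟩ : ∃ g > 0, u x + g ≤ w (-ρ) + k₁ * ρ ∧ u x + g ≤ w ρ + k₁ * ρ := by
    have h1 := hdescent (-ρ) (by rw [abs_neg, abs_of_pos hρ])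
    have h2 := hdescent ρ (abs_of_pos hρ)
    exact ⟨min (w (-ρ) + k₁ * ρ - u x) (w ρ + k₁ * ρ - u x),
      lt_min (by linarith) (by linarith),
      by linarith [min_le_left (w (-ρ) + k₁ * ρ - u x) (w ρ + k₁ * ρ - u x)],
      by linarith [min_le_right (w (-ρ) + k₁ * ρ - u x) (w ρ + k₁ * ρ - u x)]⟩
  obtain ⟨δ, hδ, hkδ⟩ : ∃ δ > 0, k₁ * δ < g :=
    ⟨g / (2 * k₁), by positivity, by field_simp; linarith⟩
  have hsub : Icc (-ρ) ρ ⊆ timeInterval (Metric.ball x r) ξ := fun t ht => hI t (abs_le.2 ht)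
  have hφ := contDiff_smoothAbs (M := k₁) (N := 0) hδ
  obtain ⟨t, ht, hmin⟩ := ((hlsc.mono hsub).add
    hφ.continuous.continuousOn.lowerSemicontinuousOn).exists_isMinOn
    (nonempty_Icc.2 (by linarith)) isCompact_Icc
  have hmin0 : w t + smoothAbs k₁ 0 δ t ≤ u x + k₁ * δ := by
    have : w t + smoothAbs k₁ 0 δ t ≤ w 0 + smoothAbs k₁ 0 δ 0 :=
      isMinOn_iff.1 hmin 0 ⟨by linarith, hρ.le⟩
    rwa [hw0, smoothAbs_zero hδ] at this
  have hlow := le_smoothAbs (N := 0) (δ := δ) hk₁0.le t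
  have htl : t ≠ -ρ := by
    rintro rfl
    rw [abs_neg, abs_of_pos hρ] at hlow
    linarith
  have htr : t ≠ ρ := by
    rintro rfl
    rw [abs_of_pos hρ] at hlow
    linarith
  have hloc : IsLocalMin (fun t => w t + smoothAbs k₁ 0 δ t) t :=
    hmin.isLocalMin (Icc_mem_nhds (lt_of_le_of_ne ht.1 htl.symm) (lt_of_le_of_ne ht.2 htr))
  have habs := htest (fun t => -smoothAbs k₁ 0 δ t) hφ.neg t (hsub ht)
    (by simpa using hloc.on (timeInterval (Metric.ball x r) ξ))
  rw [(smoothAbs_hasDerivAt hδ t).fun_neg.deriv, abs_neg] at habs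
  have hder : |smoothAbsDeriv k₁ 0 δ t| ≤ k₁ := by
    simp only [smoothAbsDeriv, mul_zero, zero_mul, add_zero]
    rw [abs_mul, abs_of_pos hk₁0]
    exact mul_le_of_le_one_right hk₁0.le (abs_div_sqrt_le_one δ t)
  linarith [(hball _ (hξR t (abs_le.2 ht))).1]

/-! ### Curves of almost steepest descent. -/

/-- The curve that follows `γ (p n)` on the time interval `[n δ, (n + 1) δ)`. -/
noncomputable def chainCurve {X : Type*} (δ : ℝ) (γ : X → ℝ → X) (p : ℕ → X) (t : ℝ) : X :=
  γ (p ⌊t / δ⌋₊) (t - ⌊t / δ⌋₊ * δ)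

theorem chainCurve_nat_mul {X : Type*} {δ : ℝ} {γ : X → ℝ → X} {p : ℕ → X}
    (hδ : 0 < δ) (hγ0 : ∀ y, γ y 0 = y) (n : ℕ) :
    chainCurve δ γ p (n * δ) = p n := by
  have : ⌊(n : ℝ) * δ / δ⌋₊ = n := by rw [mul_div_cancel_right₀ _ hδ.ne', Nat.floor_natCast]
  rw [chainCurve, this, sub_self, hγ0]

/-- Minimise `u + m d(y,·)` on the closed ball: by the triangle inequality, an interior minimiser
would have sub-slope at most `m`. -/
theorem exists_mem_sphere_descent [ProperSpace X] {y : X} {δ m : ℝ} (hδ : 0 < δ)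
    (hu : ContinuousOn u (Metric.closedBall y δ)) (hm : 0 ≤ m)
    (h : ∀ z ∈ Metric.ball y δ, ENNReal.ofReal m < subSlope u z) :
    ∃ z, dist y z = δ ∧ u z ≤ u y - m * δ := by
  have hymem : y ∈ Metric.closedBall y δ := Metric.mem_closedBall_self hδ.le
  obtain ⟨z, hz, hmin⟩ := (isCompact_closedBall y δ).exists_isMinOn ⟨y, hymem⟩
    (hu.add (continuous_const.mul (continuous_const.dist continuous_id)).continuousOn :
      ContinuousOn (fun z => u z + m * dist y z) _)
  have hzy : u z + m * dist y z ≤ u y := by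
    simpa using isMinOn_iff.1 hmin y hymem
  have hd : dist y z = δ := by
    by_contra hne
    have hlt : dist z y < δ := lt_of_le_of_ne hz (by rwa [dist_comm])
    refine (h z hlt).not_ge (subSlope_le hm ?_)
    filter_upwards [hmin.isLocalMin (Metric.closedBall_mem_nhds_of_mem hlt)] with p hp
    have := mul_le_mul_of_nonneg_left (dist_triangle y z p) hm
    simp only [Pi.add_apply] at hp
    linarith
  exact ⟨z, hd, by rw [hd] at hzy; linarith⟩

section Chain

variable {δ : ℝ} {γ : X → ℝ → X} {p : ℕ → X}

theorem floor_mul_le (hδ : 0 < δ) {t : ℝ} (ht : 0 ≤ t) : ⌊t / δ⌋₊ * δ ≤ t :=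
  (le_div_iff₀ hδ).1 (Nat.floor_le (by positivity))

theorem lt_floor_add_one_mul (hδ : 0 < δ) (t : ℝ) : t < ⌊t / δ⌋₊ * δ + δ := by
  have := (div_lt_iff₀ hδ).1 (Nat.lt_floor_add_one (t / δ))
  linarith

theorem dist_chain_le (hδ : 0 < δ) (hγ : ∀ y, LipschitzWith 1 (γ y)) (hγ0 : ∀ y, γ y 0 = y)
    (hγδ : ∀ n, γ (p n) δ = p (n + 1)) (n k : ℕ) : dist (p n) (p (n + k)) ≤ k * δ := by
  induction k with
  | zero => simp
  | succ k ih =>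
    have h1 := (hγ (p (n + k))).dist_le_mul 0 δ
    rw [hγ0, hγδ, NNReal.coe_one, one_mul, Real.dist_eq, zero_sub, abs_neg, abs_of_pos hδ] at h1
    have h2 := dist_triangle (p n) (p (n + k)) (p (n + k + 1))
    push_cast
    rw [← add_assoc]
    linarith

theorem dist_chainCurve_le (hδ : 0 < δ) (hγ : ∀ y, LipschitzWith 1 (γ y))
    (hγ0 : ∀ y, γ y 0 = y) (hγδ : ∀ n, γ (p n) δ = p (n + 1)) {s t : ℝ} (hs : 0 ≤ s)
    (hst : s ≤ t) : dist (chainCurve δ γ p s) (chainCurve δ γ p t) ≤ t - s := by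
  have hdist : ∀ (y : X) {a b : ℝ}, a ≤ b → dist (γ y a) (γ y b) ≤ b - a := fun y a b hab => by
    have := (hγ y).dist_le_mul a b
    rwa [NNReal.coe_one, one_mul, dist_comm a, Real.dist_eq, abs_of_nonneg (sub_nonneg.2 hab)]
      at this
  have hmono : ⌊s / δ⌋₊ ≤ ⌊t / δ⌋₊ := Nat.floor_mono (by gcongr)
  unfold chainCurve
  rcases hmono.eq_or_lt with heq | hlt
  · rw [heq]
    exact (hdist _ (by linarith)).trans_eq (by ring)
  · obtain ⟨k, hk⟩ := Nat.exists_eq_add_of_lt hlt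
    have h1 := hdist (p ⌊s / δ⌋₊)
      (by linarith [lt_floor_add_one_mul hδ s] : s - ⌊s / δ⌋₊ * δ ≤ δ)
    have h2 := dist_chain_le hδ hγ hγ0 hγδ (⌊s / δ⌋₊ + 1) k
    have h3 := hdist (p ⌊t / δ⌋₊) (sub_nonneg.2 (floor_mul_le hδ (hs.trans hst)))
    have hk' : ⌊s / δ⌋₊ + 1 + k = ⌊t / δ⌋₊ := by omega
    rw [hγδ] at h1
    rw [hk'] at h2
    rw [hγ0] at h3
    have hcast : (⌊t / δ⌋₊ : ℝ) = ⌊s / δ⌋₊ + 1 + k := by rw [← hk']; push_cast; ring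
    refine (dist_triangle4 _ _ _ _).trans ((add_le_add_three h1 h2 h3).trans_eq ?_)
    rw [hcast]
    ring

theorem lipschitzWith_chainCurve_abs (hδ : 0 < δ) (hγ : ∀ y, LipschitzWith 1 (γ y))
    (hγ0 : ∀ y, γ y 0 = y) (hγδ : ∀ n, γ (p n) δ = p (n + 1)) :
    LipschitzWith 1 fun t => chainCurve δ γ p |t| := by
  refine LipschitzWith.of_dist_le_mul fun s t => ?_
  rw [NNReal.coe_one, one_mul, Real.dist_eq]
  rcases le_total |s| |t| with h | h
  · refine (dist_chainCurve_le hδ hγ hγ0 hγδ (abs_nonneg s) h).trans ?_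
    rw [abs_sub_comm]
    exact abs_sub_abs_le_abs_sub t s
  · rw [dist_comm]
    exact (dist_chainCurve_le hδ hγ hγ0 hγδ (abs_nonneg t) h).trans
      (abs_sub_abs_le_abs_sub s t)

end Chain

/-- The even function with derivative `-g` on `[0, ∞)` satisfies `|w'| ≥ g` in the viscosity
sense from below, also at the concave kink at `0`. -/
theorem le_abs_deriv_of_isLocalMin_sub {g : ℝ → ℝ} (hg : Continuous g) (heven : ∀ t, g (-t) = g t)
    {a : ℝ} {φ : ℝ → ℝ} (hφ : ContDiff ℝ 1 φ) {t₀ : ℝ}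
    (hmin : IsLocalMin (fun t => (a - ∫ s in (0 : ℝ)..|t|, g s) - φ t) t₀) :
    g t₀ ≤ |deriv φ t₀| := by
  have hF : ∀ t, HasDerivAt (fun t => ∫ s in (0 : ℝ)..t, g s) (g t) t := fun t =>
    hg.integral_hasStrictDerivAt 0 t |>.hasDerivAt
  have hd : HasDerivAt φ (deriv φ t₀) t₀ := (hφ.differentiable one_ne_zero t₀).hasDerivAt
  rcases le_or_gt 0 t₀ with h0 | h0
  · have h1 : 0 ≤ -g t₀ - deriv φ t₀ :=
      HasDerivAt.nonneg_of_eventually_right (((hF t₀).const_sub a).sub hd) (by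
        filter_upwards [hmin.filter_mono nhdsWithin_le_nhds, self_mem_nhdsWithin] with t ht hlt
        rw [abs_of_nonneg h0, abs_of_nonneg (h0.trans (le_of_lt hlt))] at ht
        exact ht)
    linarith [neg_le_abs (deriv φ t₀)]
  · have hF' : HasDerivAt (fun t => ∫ s in (0 : ℝ)..(-t), g s) (-g t₀) t₀ := by
      have := (hF (-t₀)).comp t₀ (hasDerivAt_neg t₀)
      rw [heven] at this
      exact this.congr_deriv (by ring)
    have h1 : -(-g t₀) - deriv φ t₀ ≤ 0 :=
      HasDerivAt.nonpos_of_eventually_left ((hF'.const_sub a).sub hd) (by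
        filter_upwards [hmin.filter_mono nhdsWithin_le_nhds, self_mem_nhdsWithin] with t ht hlt
        rw [abs_of_neg h0, abs_of_neg (lt_trans hlt h0)] at ht
        exact ht)
    linarith [le_abs_self (deriv φ t₀)]

theorem exists_chain [ProperSpace X] (hX : IsGeodesicSpace X) {x : X} {r δ ε : ℝ}
    (hδ : 0 < δ) (hδr : δ ≤ r)
    (hfpos : ∀ y ∈ Metric.closedBall x (2 * r), 0 < f y)
    (hu : ContinuousOn u (Metric.closedBall x (2 * r)))
    (hsup : ∀ y ∈ Metric.closedBall x (2 * r), ENNReal.ofReal (f y) ≤ subSlope u y)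
    (hosc : ∀ y ∈ Metric.closedBall x (2 * r), ∀ z ∈ Metric.closedBall x (2 * r),
      dist y z ≤ δ → |f y - f z| < ε) :
    ∃ (γ : X → ℝ → X) (p : ℕ → X), p 0 = x ∧ (∀ y, LipschitzWith 1 (γ y)) ∧
      (∀ y, γ y 0 = y) ∧ (∀ n, γ (p n) δ = p (n + 1)) ∧
      (∀ n t, γ (p n) t ∈ Metric.closedBall x (2 * r)) ∧
      ∀ n, p n ∈ Metric.ball x r → u (p (n + 1)) ≤ u (p n) - (f (p n) - ε) * δ := by
  have hstep : ∀ y, ∃ γ : ℝ → X, LipschitzWith 1 γ ∧ γ 0 = y ∧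
      (y ∈ Metric.closedBall x (2 * r) → ∀ t, γ t ∈ Metric.closedBall x (2 * r)) ∧
      (y ∈ Metric.ball x r → u (γ δ) ≤ u y - (f y - ε) * δ) := by
    intro y
    by_cases hy : y ∈ Metric.ball x r
    · have hyK : Metric.closedBall y δ ⊆ Metric.closedBall x (2 * r) :=
        Metric.closedBall_subset_closedBall' (by rw [Metric.mem_ball] at hy; linarith)
      have hymem : y ∈ Metric.closedBall x (2 * r) := hyK (Metric.mem_closedBall_self hδ.le)
      -- The truncation at `0` covers `f y < ε`, since the descent rate has to be nonnegative.
      obtain ⟨z, hz, hzu⟩ := exists_mem_sphere_descent (m := max (f y - ε) 0) hδ (hu.mono hyK)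
        (le_max_right _ _) (fun z hz => by
          have hzK := hyK (Metric.ball_subset_closedBall hz)
          refine lt_of_lt_of_le ?_ (hsup z hzK)
          rw [ENNReal.ofReal_lt_ofReal_iff (hfpos z hzK)]
          refine max_lt ?_ (hfpos z hzK)
          rw [Metric.mem_ball, dist_comm] at hz
          linarith [(abs_lt.1 (hosc y hymem z hzK hz.le)).2])
      obtain ⟨γ, hγ, hγ0, hγz, hγd, -⟩ := hX.exists_curve y z
      refine ⟨γ, hγ, hγ0, fun _ t => hyK ?_, fun _ => ?_⟩
      · rw [Metric.mem_closedBall, dist_comm]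
        exact (hγd t).trans hz.le
      · rw [hγz δ hz.le]
        have := mul_le_mul_of_nonneg_right (le_max_left (f y - ε) 0) hδ.le
        linarith
    -- Outside the `r`-ball the chain stalls, so it never leaves the compact `2r`-ball.
    · exact ⟨fun _ => y, LipschitzWith.const' y, rfl, fun h _ => h, fun h => absurd h hy⟩
  choose γ hγ hγ0 hγK hγu using hstep
  have hp : ∀ n : ℕ, (fun y => γ y δ)^[n] x ∈ Metric.closedBall x (2 * r) := fun n => by
    induction n with
    | zero => exact Metric.mem_closedBall_self (by linarith)
    | succ n ih =>
      rw [Function.iterate_succ_apply']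
      exact hγK _ ih δ
  refine ⟨γ, fun n => (fun y => γ y δ)^[n] x, rfl, hγ, hγ0,
    fun n => (Function.iterate_succ_apply' (fun y => γ y δ) n x).symm,
    fun n t => hγK _ (hp n) t, fun n hn => ?_⟩
  simp only [Function.iterate_succ_apply']
  exact hγu _ hn

theorem isLocalCSupersolution_of_le_subSlope [ProperSpace X] (hX : IsGeodesicSpace X)
    (hΩ : IsOpen Ω) (hf : ContinuousOn f Ω) (hfpos : ∀ x ∈ Ω, 0 < f x)
    (hu : ContinuousOn u Ω) (h : ∀ x ∈ Ω, ENNReal.ofReal (f x) ≤ subSlope u x) :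
    IsLocalCSupersolution Ω f u := by
  refine ⟨hu.lowerSemicontinuousOn, fun x hx => ?_⟩
  obtain ⟨R, hR, hRΩ⟩ := exists_closedBall_subset (hΩ.mem_nhds hx)
  obtain ⟨r, hr, rfl⟩ : ∃ r > 0, R = 2 * r := ⟨R / 2, by positivity, by ring⟩
  have hKΩ : Metric.closedBall x (2 * r) ⊆ Ω := hRΩ
  have hrK : Metric.ball x r ⊆ Metric.closedBall x (2 * r) :=
    Metric.ball_subset_closedBall.trans (Metric.closedBall_subset_closedBall (by linarith))
  refine ⟨r, hr, hrK.trans hKΩ, fun ε hε => ?_⟩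
  have hK := isCompact_closedBall x (2 * r)
  obtain ⟨B, hB⟩ := hK.exists_bound_of_continuousOn (hf.mono hKΩ)
  have hB0 : 0 < B := by
    have hxK : x ∈ Metric.closedBall x (2 * r) := Metric.mem_closedBall_self (by linarith)
    exact (hfpos x hx).trans_le ((le_abs_self _).trans (hB x hxK))
  have hosc : ∀ v : X → ℝ, ContinuousOn v Ω → ∃ δ > 0,
      ∀ y ∈ Metric.closedBall x (2 * r), ∀ z ∈ Metric.closedBall x (2 * r),
        dist y z ≤ δ → |v y - v z| < ε / 2 := fun v hv => by
    obtain ⟨δ, hδ, hd⟩ := Metric.uniformContinuousOn_iff_le.1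
      (hK.uniformContinuousOn_of_continuous (hv.mono hKΩ)) (ε / 3) (by positivity)
    exact ⟨δ, hδ, fun y hy z hz hyz => (hd y hy z hz hyz).trans_lt (by linarith)⟩
  obtain ⟨δ₁, hδ₁, hfosc⟩ := hosc f hf
  obtain ⟨δ₂, hδ₂, huosc⟩ := hosc u hu
  -- Within one step, `f` and `u` vary by less than `ε / 2`, and the integral of `f` is at most `δ B
  -- ≤ ε / 2`.
  obtain ⟨δ, hδ, hδr, hδf, hδu, hδB⟩ :
      ∃ δ > 0, δ ≤ r ∧ δ ≤ δ₁ ∧ δ ≤ δ₂ ∧ δ ≤ ε / (2 * B) :=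
    ⟨min (min r δ₁) (min δ₂ (ε / (2 * B))), by positivity,
      (min_le_left _ _).trans (min_le_left _ _), (min_le_left _ _).trans (min_le_right _ _),
      (min_le_right _ _).trans (min_le_left _ _), (min_le_right _ _).trans (min_le_right _ _)⟩
  rw [le_div_iff₀ (by positivity)] at hδB
  obtain ⟨γ, p, hp0, hγ, hγ0, hγδ, hγK, hdesc⟩ := exists_chain (ε := ε / 2) hX hδ
    hδr (fun y hy => hfpos y (hKΩ hy)) (hu.mono hKΩ) (fun y hy => h y (hKΩ hy))
    (fun y hy z hz hyz => hfosc y hy z hz (hyz.trans hδf))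
  set ξ : ℝ → X := fun t => chainCurve δ γ p |t| with hξdef
  have hξ : LipschitzWith 1 ξ := lipschitzWith_chainCurve_abs hδ hγ hγ0 hγδ
  have hξn : ∀ n : ℕ, ξ (n * δ) = p n := fun n => by
    rw [hξdef]
    simp only
    rw [abs_of_nonneg (by positivity), chainCurve_nat_mul hδ hγ0]
  have hξ0 : ξ 0 = x := by simpa [hp0] using hξn 0
  have hξK : ∀ t, ξ t ∈ Metric.closedBall x (2 * r) := fun t => hγK _ _
  have hξeven : ∀ t, ξ (-t) = ξ t := fun t => by simp [hξdef]
  have hξp : ∀ (n : ℕ) (t : ℝ), n * δ ≤ t → t ≤ n * δ + δ → dist (p n) (ξ t) ≤ δ :=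
    fun n t h1 h2 => by
      have := hξ.dist_le_mul (n * δ) t
      rw [hξn, NNReal.coe_one, one_mul, dist_comm (n * δ), Real.dist_eq,
        abs_of_nonneg (by linarith)] at this
      linarith
  have hpK : ∀ n, p n ∈ Metric.closedBall x (2 * r) := fun n => hξn n ▸ hξK _
  have hg : Continuous fun t => f (ξ t) - ε :=
    (hf.comp_continuous hξ.continuous fun t => hKΩ (hξK t)).sub continuous_const
  have hint : ∀ a b, IntervalIntegrable (fun t => f (ξ t) - ε) MeasureTheory.volume a b :=
    fun a b => hg.intervalIntegrable a b
  have hpu : ∀ n : ℕ, (∀ j < n, p j ∈ Metric.ball x r) →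
      u (p n) ≤ u x - ∫ s in (0 : ℝ)..(n * δ), (f (ξ s) - ε) := fun n => by
    induction n with
    | zero => simp [hp0]
    | succ n ih =>
      intro hj
      have h1 := ih fun j hjn => hj j (by omega)
      have h2 := hdesc n (hj n (by omega))
      -- The descent loses `ε / 2` and the oscillation of `f` another `ε / 2`, which uses up the `ε`
      -- in the integrand.
      have h3 : ∫ s in (n * δ)..(n * δ + δ), (f (ξ s) - ε) ≤
          ∫ _ in (n * δ)..(n * δ + δ), (f (p n) - ε / 2) := by
        refine intervalIntegral.integral_mono_on (by linarith) (hint _ _)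
          intervalIntegrable_const fun s hs => ?_
        have := hfosc _ (hpK n) _ (hξK s) ((hξp n s hs.1 hs.2).trans hδf)
        linarith [(abs_lt.1 this).1]
      rw [intervalIntegral.integral_const, smul_eq_mul, add_sub_cancel_left] at h3
      have h4 := intervalIntegral.integral_add_adjacent_intervals (hint 0 (n * δ))
        (hint (n * δ) (n * δ + δ))
      have h5 : ((n + 1 : ℕ) : ℝ) * δ = n * δ + δ := by push_cast; ring
      rw [h5, ← h4]
      linarith
  refine ⟨ξ, fun t => u x - ∫ s in (0 : ℝ)..|t|, (f (ξ s) - ε), ⟨hξ, hξ0⟩, ?_, ?_, ?_, ?_⟩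
  · have hF : Continuous fun t => ∫ s in (0 : ℝ)..t, (f (ξ s) - ε) :=
      intervalIntegral.continuous_primitive hint 0
    exact (continuous_const.sub (hF.comp continuous_abs)).continuousOn.lowerSemicontinuousOn
  · simp
  · intro t ht
    have hin : ∀ s, 0 ≤ s → s ≤ |t| → ξ s ∈ Metric.ball x r := fun s hs hst => by
      rcases le_total 0 t with h0 | h0
      · rw [abs_of_nonneg h0] at hst
        exact mem_of_mem_timeInterval ht (by rw [uIcc_of_le h0]; exact ⟨hs, hst⟩)
      · rw [abs_of_nonpos h0] at hst
        rw [← hξeven]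
        exact mem_of_mem_timeInterval ht (by
          rw [uIcc_of_ge h0]; exact ⟨by linarith, by linarith⟩)
    -- Compare with the last node before `|t|`: the partial step costs `ε / 2` for `u` and `ε / 2`
    -- for the integral.
    set n := ⌊|t| / δ⌋₊
    have hn : n * δ ≤ |t| := floor_mul_le hδ (abs_nonneg t)
    have hn' : |t| ≤ n * δ + δ := (lt_floor_add_one_mul hδ |t|).le
    have h1 := hpu n fun j hj => by
      rw [← hξn]
      refine hin _ (by positivity) (le_trans ?_ hn)
      gcongr
    have hξabs : ξ |t| = ξ t := by simp [hξdef]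
    have h2 := huosc _ (hpK n) _ (hξK |t|) ((hξp n |t| hn hn').trans hδu)
    rw [hξabs] at h2
    have h3 : ∫ s in (n * δ)..|t|, (f (ξ s) - ε) ≤ ∫ _ in (n * δ)..|t|, B :=
      intervalIntegral.integral_mono_on hn (hint _ _) intervalIntegrable_const fun s _ => by
        linarith [(le_abs_self _).trans (hB _ (hξK s))]
    rw [intervalIntegral.integral_const, smul_eq_mul] at h3
    have h4 := intervalIntegral.integral_add_adjacent_intervals (hint 0 (n * δ))
      (hint (n * δ) |t|)
    have h5 : (|t| - n * δ) * B ≤ δ * B := by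
      gcongr
      linarith
    simp only [← h4]
    linarith [(abs_lt.1 h2).1]
  · intro φ hφ t₀ ht₀ hmin
    exact le_abs_deriv_of_isLocalMin_sub hg (fun t => by rw [hξeven]) hφ
      (hmin.isLocalMin ((isOpen_timeInterval _ ξ).mem_nhds ht₀))

/-! ### Equivalence through Monge solutions. -/

theorem isMongeSolution_of_hasLipschitzBound (hfpos : ∀ x ∈ Ω, 0 < f x)
    (hL : HasLipschitzBound Ω f u) (hsup : ∀ x ∈ Ω, ENNReal.ofReal (f x) ≤ subSlope u x) :
    IsMongeSolution Ω f u :=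
  ⟨⟨hL.locallyLipschitzOn hfpos, fun x hx =>
    (subSlope_le_localSlope u x).trans (hL.localSlope_le hfpos hx)⟩,
    hL.locallyLipschitzOn hfpos, hsup⟩

theorem IsLocalCSolution.isMongeSolution (hX : IsGeodesicSpace X) (hΩ : IsOpen Ω)
    (hf : ContinuousOn f Ω) (hfpos : ∀ x ∈ Ω, 0 < f x) (h : IsLocalCSolution Ω f u) :
    IsMongeSolution Ω f u :=
  isMongeSolution_of_hasLipschitzBound hfpos (h.2.1.hasLipschitzBound hX hΩ hf hfpos h.1)
    fun _ hx => h.2.2.le_subSlope hΩ hf hx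

theorem IsSSolution.isMongeSolution [ProperSpace X] (hX : IsGeodesicSpace X) (hΩ : IsOpen Ω)
    (hf : ContinuousOn f Ω) (hfpos : ∀ x ∈ Ω, 0 < f x) (h : IsSSolution Ω f u) :
    IsMongeSolution Ω f u :=
  isMongeSolution_of_hasLipschitzBound hfpos (h.2.1.hasLipschitzBound hX hΩ hf hfpos h.1)
    fun _ hx => h.2.2.le_subSlope hX hΩ hf h.1 hx

theorem IsMongeSolution.isLocalCSolution [ProperSpace X] (hX : IsGeodesicSpace X)
    (hΩ : IsOpen Ω) (hf : ContinuousOn f Ω) (hfpos : ∀ x ∈ Ω, 0 < f x)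
    (hu : ContinuousOn u Ω) (h : IsMongeSolution Ω f u) : IsLocalCSolution Ω f u :=
  ⟨hu, isCSubsolution_of_subSlope_le hu hfpos h.1.2,
    isLocalCSupersolution_of_le_subSlope hX hΩ hf hfpos hu h.2.2⟩

theorem IsMongeSolution.isSSolution (hΩ : IsOpen Ω) (hu : ContinuousOn u Ω)
    (h : IsMongeSolution Ω f u) : IsSSolution Ω f u :=
  ⟨hu, isSSubsolution_of_subSlope_le hΩ hu h.1.2, isSSupersolution_of_le_subSlope hΩ hu h.2.2⟩

/-- The Monge condition bounds only descent at each point. Passing through c-subsolutions gives a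
Lipschitz bound for all ordered pairs of nearby points, which controls ascent as well. -/
theorem IsMongeSolution.localSlope_eq (hX : IsGeodesicSpace X) (hΩ : IsOpen Ω)
    (hf : ContinuousOn f Ω) (hfpos : ∀ x ∈ Ω, 0 < f x) (hu : ContinuousOn u Ω)
    (h : IsMongeSolution Ω f u) {x : X} (hx : x ∈ Ω) :
    localSlope u x = ENNReal.ofReal (f x) :=
  (((isCSubsolution_of_subSlope_le hu hfpos h.1.2).hasLipschitzBound hX hΩ hf hfpos
    hu).localSlope_le hfpos hx).antisymm
      ((h.2.2 x hx).trans (subSlope_le_localSlope u x))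

end MetricEikonal

theorem corollary4p8 {X : Type*} [MetricSpace X] [ProperSpace X] [CompleteSpace X]
    (hX : MetricEikonal.IsGeodesicSpace X)
    (Ω : Set X) (hΩ : IsOpen Ω) (hbdd : Bornology.IsBounded Ω)
    (f : X → ℝ) (hf : ContinuousOn f Ω) (hfpos : ∀ x ∈ Ω, 0 < f x)
    (u : X → ℝ) (hu : ContinuousOn u Ω) :
    List.TFAE [MetricEikonal.IsLocalCSolution Ω f u,
        MetricEikonal.IsSSolution Ω f u,
        MetricEikonal.IsMongeSolution Ω f u] ∧
      (MetricEikonal.IsCSolution Ω f u → MetricEikonal.IsLocalCSolution Ω f u) ∧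
      ((MetricEikonal.IsLocalCSolution Ω f u ∨ MetricEikonal.IsSSolution Ω f u ∨
          MetricEikonal.IsMongeSolution Ω f u) →
        LocallyLipschitzOn Ω u ∧ ∀ x ∈ Ω,
          MetricEikonal.localSlope u x = ENNReal.ofReal (f x) ∧
          MetricEikonal.subSlope u x = ENNReal.ofReal (f x)) := by
  have hcm := fun h => MetricEikonal.IsLocalCSolution.isMongeSolution (u := u) hX hΩ hf hfpos h
  have hsm := fun h => MetricEikonal.IsSSolution.isMongeSolution (u := u) hX hΩ hf hfpos h
  refine ⟨?_, MetricEikonal.IsCSolution.isLocalCSolution hΩ, fun h => ?_⟩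
  · tfae_have 1 → 3 := hcm
    tfae_have 3 → 1 := fun h => h.isLocalCSolution hX hΩ hf hfpos hu
    tfae_have 2 → 3 := hsm
    tfae_have 3 → 2 := fun h => h.isSSolution hΩ hu
    tfae_finish
  · have hm : MetricEikonal.IsMongeSolution Ω f u := by
      rcases h with h | h | h
      exacts [hcm h, hsm h, h]
    exact ⟨hm.1.1, fun x hx => ⟨hm.localSlope_eq hX hΩ hf hfpos hu hx,
      (hm.1.2 x hx).antisymm (hm.2.2 x hx)⟩⟩
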